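/- Let $\mathbb{D}=\{|z|<1\}$, $\mathbb{T}=\{|z|=1\}$. For $\alpha\in\mathbb{R}$ and $u\in C^2(\mathbb{D})$ (complex valued) put $$T_\alpha u=-\frac{\alpha^2}{4}(1-|z|^2)^{-\alpha-1}u+\frac{\alpha}{2}(1-|z|^2)^{-\alpha-1}\Big(z\frac{\partial u}{\partial z}+\bar z\frac{\partial u}{\partial\bar z}\Big)+\frac14(1-|z|^2)^{-\alpha}\Delta u ,$$ and for continuous $f:\mathbb{T}\to\mathbb{C}$ and $\alpha>-1$ put $$P_\alpha[f](z)=\frac1{2\pi}\int_0^{2\pi}K_\alpha(ze^{-it})f(e^{it})\,dt,\qquad K_\alpha(z)=\frac{\Gamma(\alpha/2+1)^2}{\Gamma(1+\alpha)}\,\frac{(1-|z|^2)^{\alpha+1}}{|1-z|^{\alpha+2}}\qquad(z\in\mathbb{D}).$$ A solution of the Dirichlet problem $$T_\alpha u=0\ \text{ in }\mathbb{D},\qquad u=f\ \text{ on }\mathbb{T}$$ is a function $u\in C^2(\mathbb{D})$ with $T_\alpha u=0$ in $\mathbb{D}$ such that $u_r\to f$ in $\mathfrak{D}'(\mathbb{T})$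 as $r\to1^-$, where $u_r(e^{it})=u(re^{it})$; that is, $\int_0^{2\pi}u(re^{it})\varphi(e^{it})\,dt\to\int_0^{2\pi}f(e^{it})\varphi(e^{it})\,dt$ for every $\varphi\in C^\infty(\mathbb{T})$. **Theorem 1.2.** Let $\alpha>-1$ and let $f:\mathbb{T}\to\mathbb{C}$ be continuous. Then the function $u$ on $\overline{\mathbb{D}}$ that is equal to $P_\alpha[f]$ in $\mathbb{D}$ and to $f$ on $\mathbb{T}$ is continuous on $\overline{\mathbb{D}}$ and solves the Dirichlet problem, and it is the only solution that is continuous on $\overline{\mathbb{D}}$. It is also the only continuous function on $\overline{\mathbb{D}}$ that is $C^2$ in $\mathbb{D}$, satisfies $T_\alpha u=0$ in $\mathbb{D}$ and equals $f$ at every point of $\mathbb{T}$; and every solution of the Dirichlet problem, whether or not it is assumed to be continuous up to $\mathbb{T}$, equals $P_\alpha[f]$ in $\mathbb{D}$. -/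

import Mathlib

open scoped ContDiff

noncomputable section

namespace AlphaHarmonic

/-- The Wirtinger derivative `∂u/∂z = (∂u/∂x - i ∂u/∂y) / 2`. -/
def wirtingerZ (u : ℂ → ℂ) (z : ℂ) : ℂ :=
  (fderiv ℝ u z 1 - Complex.I * fderiv ℝ u z Complex.I) / 2

/-- The Wirtinger derivative `∂u/∂z̄ = (∂u/∂x + i ∂u/∂y) / 2`. -/
def wirtingerZbar (u : ℂ → ℂ) (z : ℂ) : ℂ :=
  (fderiv ℝ u z 1 + Complex.I * fderiv ℝ u z Complex.I) / 2

/-- The operator `T_α` on the unit disk; the Laplacian is Mathlib's, for `ℂ` regarded as the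
Euclidean plane. -/
def T (α : ℝ) (u : ℂ → ℂ) (z : ℂ) : ℂ :=
  -((α ^ 2 / 4 * (1 - ‖z‖ ^ 2) ^ (-α - 1) : ℝ) : ℂ) * u z
    + ((α / 2 * (1 - ‖z‖ ^ 2) ^ (-α - 1) : ℝ) : ℂ)
      * (z * wirtingerZ u z + (starRingEnd ℂ) z * wirtingerZbar u z)
    + ((1 / 4 * (1 - ‖z‖ ^ 2) ^ (-α) : ℝ) : ℂ) * Laplacian.laplacian u z

/-- `u` is a `C²` solution of `T_α u = 0` in the open unit disk. -/
structure IsAlphaHarmonic (α : ℝ) (u : ℂ → ℂ) : Prop where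
  contDiffOn : ContDiffOn ℝ 2 u (Metric.ball 0 1)
  eq_zero : ∀ z ∈ Metric.ball (0 : ℂ) 1, T α u z = 0

/-- `u_r → f` as `r → 1⁻` in the sense of distributions on the circle, where
`u_r(e^{it}) = u(r e^{it})`. The test functions are the smooth functions on the circle, written
as smooth `2π`-periodic functions of the angle. -/
def HasDistributionalBoundaryValue (u : ℂ → ℂ) (f : Circle → ℂ) : Prop :=
  ∀ φ : ℝ → ℂ, ContDiff ℝ ∞ φ → Function.Periodic φ (2 * Real.pi) →
    Filter.Tendsto
      (fun r : ℝ => ∫ t in (0 : ℝ)..(2 * Real.pi), u ((r : ℂ) * (Circle.exp t : ℂ)) * φ t)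
      (nhdsWithin 1 (Set.Iio 1))
      (nhds (∫ t in (0 : ℝ)..(2 * Real.pi), f (Circle.exp t) * φ t))

/-- `u` solves the Dirichlet problem `T_α u = 0` in the open disk, `u = f` on the circle, the
boundary condition being understood in the sense of distributions. -/
structure IsDirichletSolution (α : ℝ) (f : Circle → ℂ) (u : ℂ → ℂ) : Prop where
  isAlphaHarmonic : IsAlphaHarmonic α u
  boundary : HasDistributionalBoundaryValue u f

/-- The kernel `K_α(z) = c_α (1 - |z|²)^(α+1) / |1 - z|^(α+2)` with
`c_α = Γ(α/2 + 1)² / Γ(1 + α)`. -/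
def kernel (α : ℝ) (z : ℂ) : ℝ :=
  Real.Gamma (α / 2 + 1) ^ 2 / Real.Gamma (1 + α)
    * ((1 - ‖z‖ ^ 2) ^ (α + 1) / ‖1 - z‖ ^ (α + 2))

/-- The Poisson type integral `P_α[f](z) = (1/2π) ∫₀^{2π} K_α(z e^{-it}) f(e^{it}) dt`. -/
def poisson (α : ℝ) (f : Circle → ℂ) (z : ℂ) : ℂ :=
  1 / (2 * (Real.pi : ℂ))
    * ∫ t in (0 : ℝ)..(2 * Real.pi),
        (kernel α (z * (Circle.exp (-t) : ℂ)) : ℂ) * f (Circle.exp t)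

end AlphaHarmonic

end

/-! Existence. Multiplied by `4 (1 - |z|²)^(α + 1)`, the operator becomes `L u = (1 - |z|²) Δu + 2α
Du(z)z - α² u`, which commutes with rotations. A direct computation gives `L K_α = 0`, and `P_α[f]`
is an average of rotated kernels, hence α-harmonic (`IsAlphaHarmonic.rotAverage`). The boundary
limit comes from the substitution `s = 2 arctan(ρ y)` with `ρ = (1 - r)/(1 + r)`: it blows up the
peak of the kernel, removes every singular power of `1 - r`, and leaves an integral over `ℝ` to
which dominated convergence applies (`tendsto_poisson_polar`). Its limiting mass is 1 by Legendre's
duplication formula.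

Uniqueness. Let `w` be α-harmonic with distributional boundary value 0. Averaging its rotations
against a character isolates one Fourier mode of `w`. That mode is again α-harmonic, and its modulus
depends only on `|z|`, so convergence against a single test function already makes it tend to 0
uniformly at the circle. The maximum principle (`IsAlphaHarmonic.re_nonpos`) kills it. All Fourier
coefficients of `w` on every circle vanish, so `w = 0`. -/

namespace AlphaHarmonic

open Filter Topology Set Metric MeasureTheory

/-! ### Continuity and differentiation of integrals depending on a parameter. -/

section ParametricIntegral

variable {H E : Type*} [NormedAddCommGroup H] [NormedAddCommGroup E]

/-- Compactness of a closed ball times the interval supplies a constant dominating function. -/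
theorem exists_ball_bound [ProperSpace H] {G : H → ℝ → E} {s : Set H} (hs : IsOpen s) (a b : ℝ)
    (hG : ContinuousOn (Function.uncurry G) (s ×ˢ univ)) {x : H} (hx : x ∈ s) :
    ∃ δ > 0, ball x δ ⊆ s ∧ ∃ C, ∀ y ∈ ball x δ, ∀ t ∈ uIcc a b, ‖G y t‖ ≤ C := by
  obtain ⟨δ, hδ, hsub⟩ := nhds_basis_closedBall.mem_iff.1 (hs.mem_nhds hx)
  obtain ⟨C, hC⟩ := ((isCompact_closedBall x δ).prod (isCompact_uIcc (a := a) (b := b)))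
    |>.exists_bound_of_continuousOn (hG.mono (prod_mono hsub (subset_univ _)))
  exact ⟨δ, hδ, ball_subset_closedBall.trans hsub, C,
    fun y hy t ht => hC (y, t) ⟨ball_subset_closedBall hy, ht⟩⟩

theorem continuous_slice {X Y : Type*} [TopologicalSpace X] [TopologicalSpace Y]
    {G : X → ℝ → Y} {s : Set X}
    (hG : ContinuousOn (Function.uncurry G) (s ×ˢ univ)) {x : X} (hx : x ∈ s) :
    Continuous (G x) := by
  rw [← continuousOn_univ]
  exact hG.comp (f := fun t => (x, t)) (by fun_prop) (fun t _ => ⟨hx, trivial⟩)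

variable [NormedSpace ℝ E]

theorem continuousOn_integral_of_continuousOn_prod [ProperSpace H] {G : H → ℝ → E}
    {s : Set H} (hs : IsOpen s)
    (a b : ℝ) (hG : ContinuousOn (Function.uncurry G) (s ×ˢ univ)) :
    ContinuousOn (fun x => ∫ t in a..b, G x t) s := by
  intro x hx
  obtain ⟨δ, hδ, hsub, C, hC⟩ := exists_ball_bound hs a b hG hx
  have hnhds : ball x δ ∈ 𝓝 x := ball_mem_nhds x hδ
  refine (intervalIntegral.continuousAt_of_dominated_interval (bound := fun _ => C)
    ?_ ?_ (by simp) ?_).continuousWithinAt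
  · filter_upwards [hnhds] with y hy
    exact (continuous_slice hG (hsub hy)).aestronglyMeasurable
  · filter_upwards [hnhds] with y hy
    exact .of_forall fun t ht => hC y hy t (uIoc_subset_uIcc ht)
  · refine .of_forall fun t _ => ?_
    have : ContinuousOn (fun y => G y t) s :=
      hG.comp (f := fun y => (y, t)) (by fun_prop) (fun y hy => ⟨hy, trivial⟩)
    exact this.continuousAt (hs.mem_nhds hx)

theorem hasFDerivAt_integral_of_continuousOn_prod [NormedSpace ℝ H] [ProperSpace H]
    {G : H → ℝ → E} {G' : H → ℝ → H →L[ℝ] E}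
    {s : Set H} (hs : IsOpen s) (a b : ℝ) (hG : ContinuousOn (Function.uncurry G) (s ×ˢ univ))
    (hG' : ContinuousOn (Function.uncurry G') (s ×ˢ univ))
    (hd : ∀ x ∈ s, ∀ t, HasFDerivAt (fun y => G y t) (G' x t) x) {x : H} (hx : x ∈ s) :
    HasFDerivAt (fun y => ∫ t in a..b, G y t) (∫ t in a..b, G' x t) x := by
  obtain ⟨δ, hδ, hsub, C, hC⟩ := exists_ball_bound hs a b hG' hx
  have hnhds : ball x δ ∈ 𝓝 x := ball_mem_nhds x hδ
  refine intervalIntegral.hasFDerivAt_integral_of_dominated_of_fderiv_le (bound := fun _ => C)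
    hnhds ?_ ((continuous_slice hG hx).intervalIntegrable _ _)
    (continuous_slice hG' hx).aestronglyMeasurable
    (.of_forall fun t ht y hy => hC y hy t (uIoc_subset_uIcc ht)) (by simp)
    (.of_forall fun t _ y hy => hd y (hsub hy) t)
  filter_upwards [hnhds] with y hy
  exact (continuous_slice hG (hsub hy)).aestronglyMeasurable

end ParametricIntegral

/-! ### Derivatives along real lines and the second derivative test. -/

section Lines

variable {E : Type*} [NormedAddCommGroup E] [NormedSpace ℝ E]

theorem hasDerivAt_line {u : ℂ → E} {z v : ℂ} {s : ℝ}
    (hu : DifferentiableAt ℝ u (z + s • v)) :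
    HasDerivAt (fun s : ℝ => u (z + s • v)) (fderiv ℝ u (z + s • v) v) s := by
  have h : HasDerivAt (fun s : ℝ => z + s • v) v s := by
    simpa using ((hasDerivAt_id s).smul_const v).const_add z
  exact hu.hasFDerivAt.comp_hasDerivAt s h

theorem hasDerivAt_fderiv_line {u : ℂ → E} {z v : ℂ} (hu : ContDiffAt ℝ 2 u z) :
    HasDerivAt (fun s : ℝ => fderiv ℝ u (z + s • v) v) (fderiv ℝ (fderiv ℝ u) z v v) 0 := by
  have h1 : DifferentiableAt ℝ (fderiv ℝ u) (z + (0 : ℝ) • v) := by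
    simpa using (hu.fderiv_right (m := 1) (by norm_num)).differentiableAt (by norm_num)
  have := (hasDerivAt_line h1).clm_apply (hasDerivAt_const (0 : ℝ) v)
  simpa using this

theorem tendsto_line (z v : ℂ) : Tendsto (fun s : ℝ => z + s • v) (𝓝 0) (𝓝 z) := by
  have : Continuous (fun s : ℝ => z + s • v) := by fun_prop
  simpa using this.tendsto 0

theorem eventually_hasDerivAt_line {u : ℂ → E} {z : ℂ} (hu : ContDiffAt ℝ 2 u z) (v : ℂ) :
    ∀ᶠ s : ℝ in 𝓝 0, HasDerivAt (fun s : ℝ => u (z + s • v)) (fderiv ℝ u (z + s • v) v) s := by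
  filter_upwards [(tendsto_line z v).eventually (hu.eventually (by simp))] with s hs
  exact hasDerivAt_line (hs.differentiableAt (by norm_num))

theorem fderiv_eq_of_line {u : ℂ → E} {z v : ℂ} (hu : ContDiffAt ℝ 2 u z) {h' : ℝ → E}
    (h1 : ∀ᶠ s : ℝ in 𝓝 0, HasDerivAt (fun s : ℝ => u (z + s • v)) (h' s) s) :
    fderiv ℝ u z v = h' 0 := by
  have := (eventually_hasDerivAt_line hu v).self_of_nhds.unique h1.self_of_nhds
  simpa using this

/-- Reduces pure second derivatives to one-variable calculus. The formula for `h'` is needed near 0,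
not only at 0, because it is differentiated again. -/
theorem fderiv_fderiv_eq_of_line {u : ℂ → E} {z v : ℂ} (hu : ContDiffAt ℝ 2 u z) {h' : ℝ → E}
    {h'' : E} (h1 : ∀ᶠ s : ℝ in 𝓝 0, HasDerivAt (fun s : ℝ => u (z + s • v)) (h' s) s)
    (h2 : HasDerivAt h' h'' 0) : fderiv ℝ (fderiv ℝ u) z v v = h'' := by
  refine (hasDerivAt_fderiv_line (v := v) hu).unique (h2.congr_of_eventuallyEq ?_)
  filter_upwards [eventually_hasDerivAt_line hu v, h1] with s hs hs'
  exact hs.unique hs'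

/-- If `c > 0`, the second derivative test makes 0 a local minimum as well; then `φ` is locally
constant and `c = 0`. -/
theorem second_deriv_nonpos_of_isLocalMax {φ φ' : ℝ → ℝ} {c : ℝ}
    (h1 : ∀ᶠ s in 𝓝 0, HasDerivAt φ (φ' s) s) (h2 : HasDerivAt φ' c 0)
    (hmax : IsLocalMax φ 0) : φ' 0 = 0 ∧ c ≤ 0 := by
  have h0 : φ' 0 = 0 := hmax.hasDerivAt_eq_zero h1.self_of_nhds
  refine ⟨h0, ?_⟩
  by_contra! hc
  have hd : deriv φ =ᶠ[𝓝 0] φ' := h1.mono fun s hs => hs.deriv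
  have hdd : deriv (deriv φ) 0 = c := by rw [hd.deriv_eq]; exact h2.deriv
  have hmin := isLocalMin_of_deriv_deriv_pos (f := φ) (x₀ := 0) (by rwa [hdd])
    (by rw [hd.self_of_nhds, h0]) h1.self_of_nhds.continuousAt
  have hconst : φ =ᶠ[𝓝 0] fun _ => φ 0 := by
    filter_upwards [hmin, hmax] with s hs hs' using le_antisymm hs' hs
  have : deriv φ =ᶠ[𝓝 0] fun _ => 0 := by
    simpa using hconst.deriv
  have h3 := this.deriv_eq
  rw [hdd] at h3
  simp at h3
  exact hc.ne' h3

end Lines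

/-! ### The operator with polynomial coefficients. -/

/-- The operator `4 (1 - |z|²)^(α + 1) T_α`, written with real Fréchet derivatives. -/
noncomputable def L (α : ℝ) (u : ℂ → ℂ) (z : ℂ) : ℂ :=
  (1 - ‖z‖ ^ 2 : ℝ) * (fderiv ℝ (fderiv ℝ u) z 1 1
    + fderiv ℝ (fderiv ℝ u) z Complex.I Complex.I)
    + (2 * α : ℝ) * fderiv ℝ u z z - (α ^ 2 : ℝ) * u z

theorem fderiv_apply_self (u : ℂ → ℂ) (z : ℂ) :
    fderiv ℝ u z z = z.re • fderiv ℝ u z 1 + z.im • fderiv ℝ u z Complex.I := by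
  rw [← map_smul, ← map_smul, ← map_add]
  congr 1
  simp [Complex.re_add_im]

/-- The first-order part of `T_α` is the Euler (radial) derivative: it is invariant under rotations
and vanishes at critical points. -/
theorem wirtinger_euler (u : ℂ → ℂ) (z : ℂ) :
    z * wirtingerZ u z + (starRingEnd ℂ) z * wirtingerZbar u z = fderiv ℝ u z z := by
  have hz := Complex.re_add_im z
  have hz' : (starRingEnd ℂ) z = z.re - z.im * Complex.I := by
    apply Complex.ext <;> simp
  rw [fderiv_apply_self, hz', wirtingerZ, wirtingerZbar, Complex.real_smul, Complex.real_smul]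
  linear_combination -(fderiv ℝ u z 1 - Complex.I * fderiv ℝ u z Complex.I) / 2 * hz
    - (z.im : ℂ) * (fderiv ℝ u z Complex.I) * Complex.I_sq

theorem T_eq (α : ℝ) (u : ℂ → ℂ) {z : ℂ} (hz : z ∈ ball (0 : ℂ) 1) :
    T α u z = ((1 - ‖z‖ ^ 2) ^ (-α - 1) / 4 : ℝ) * L α u z := by
  have hz1 : 0 < 1 - ‖z‖ ^ 2 := by
    have : ‖z‖ < 1 := by simpa using hz
    nlinarith [norm_nonneg z]
  have hpow : (1 - ‖z‖ ^ 2) ^ (-α) = (1 - ‖z‖ ^ 2) ^ (-α - 1) * (1 - ‖z‖ ^ 2) := by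
    rw [← Real.rpow_add_one hz1.ne']; ring_nf
  rw [T, L, wirtinger_euler, hpow, InnerProductSpace.laplacian_eq_iteratedFDeriv_complexPlane]
  simp only [iteratedFDeriv_two_apply]
  simp only [Matrix.cons_val_zero, Matrix.cons_val_one]
  push_cast
  ring

theorem T_eq_zero_iff (α : ℝ) (u : ℂ → ℂ) {z : ℂ} (hz : z ∈ ball (0 : ℂ) 1) :
    T α u z = 0 ↔ L α u z = 0 := by
  have hz1 : 0 < 1 - ‖z‖ ^ 2 := by
    have : ‖z‖ < 1 := by simpa using hz
    nlinarith [norm_nonneg z]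
  rw [T_eq α u hz, mul_eq_zero, or_iff_right]
  have := Real.rpow_pos_of_pos hz1 (-α - 1)
  exact_mod_cast (by positivity : (1 - ‖z‖ ^ 2) ^ (-α - 1) / 4 ≠ 0)

/-! ### Rotations and rotation averages. -/

/-- Multiplication by `e^{-it}` as a real linear map of the plane. -/
noncomputable def rot (t : ℝ) : ℂ →L[ℝ] ℂ := ((Circle.exp (-t) : ℂ)) • ContinuousLinearMap.id ℝ ℂ

theorem rot_apply (t : ℝ) (z : ℂ) : rot t z = z * (Circle.exp (-t) : ℂ) := by
  simp [rot, mul_comm]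

theorem continuous_rot : Continuous rot := by
  unfold rot
  fun_prop

theorem norm_rot_apply (t : ℝ) (z : ℂ) : ‖rot t z‖ = ‖z‖ := by
  simp [rot_apply]

theorem rot_mem_ball {t : ℝ} {z : ℂ} {r : ℝ} (hz : z ∈ ball (0 : ℂ) r) :
    rot t z ∈ ball (0 : ℂ) r := by
  simpa [norm_rot_apply] using hz

theorem continuousOn_comp_rot {F : Type*} [TopologicalSpace F] {k : ℂ → F}
    (hk : ContinuousOn k (ball 0 1)) :
    ContinuousOn (fun p : ℂ × ℝ => k (rot p.2 p.1)) (ball (0 : ℂ) 1 ×ˢ univ) := by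
  refine hk.comp (f := fun p : ℂ × ℝ => rot p.2 p.1) ?_ (fun p hp => rot_mem_ball hp.1)
  exact ((continuous_rot.comp continuous_snd).clm_apply continuous_fst).continuousOn

section RotAverage

variable {k : ℂ → ℂ} {g : ℝ → ℂ}

/-- The rotation average of `k` against the weight `g`. -/
noncomputable def rotAverage (k : ℂ → ℂ) (g : ℝ → ℂ) (z : ℂ) : ℂ :=
  ∫ t in (0 : ℝ)..(2 * Real.pi), g t • k (rot t z)

/-- The derivative of the integrand of `rotAverage`. -/
noncomputable def rotIntegrand₁ (k : ℂ → ℂ) (g : ℝ → ℂ) (z : ℂ) (t : ℝ) : ℂ →L[ℝ] ℂ :=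
  g t • (fderiv ℝ k (rot t z)).comp (rot t)

/-- The second derivative of the integrand of `rotAverage`. -/
noncomputable def rotIntegrand₂ (k : ℂ → ℂ) (g : ℝ → ℂ) (z : ℂ) (t : ℝ) : ℂ →L[ℝ] ℂ →L[ℝ] ℂ :=
  ((ContinuousLinearMap.compL ℝ ℂ ℂ ℂ).flip (rot t)).comp
    ((ContinuousLinearMap.compL ℝ ℂ ℂ ℂ (g t • ContinuousLinearMap.id ℝ ℂ)).comp
      ((fderiv ℝ (fderiv ℝ k) (rot t z)).comp (rot t)))

theorem continuousOn_rotIntegrand₁ (hk : ContDiffOn ℝ 2 k (ball 0 1)) (hg : Continuous g) :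
    ContinuousOn (Function.uncurry (rotIntegrand₁ k g)) (ball (0 : ℂ) 1 ×ˢ univ) := by
  have hg' : ContinuousOn (fun p : ℂ × ℝ => g p.2) (ball (0 : ℂ) 1 ×ˢ univ) := by fun_prop
  have hr' : ContinuousOn (fun p : ℂ × ℝ => rot p.2) (ball (0 : ℂ) 1 ×ˢ univ) :=
    (continuous_rot.comp continuous_snd).continuousOn
  exact hg'.smul ((continuousOn_comp_rot
      (hk.continuousOn_fderiv_of_isOpen isOpen_ball (by norm_num))).clm_comp hr')

theorem continuousOn_rotIntegrand₂ (hk : ContDiffOn ℝ 2 k (ball 0 1)) (hg : Continuous g) :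
    ContinuousOn (Function.uncurry (rotIntegrand₂ k g)) (ball (0 : ℂ) 1 ×ˢ univ) := by
  have hg' : ContinuousOn (fun p : ℂ × ℝ => g p.2) (ball (0 : ℂ) 1 ×ˢ univ) := by fun_prop
  have hr' : ContinuousOn (fun p : ℂ × ℝ => rot p.2) (ball (0 : ℂ) 1 ×ˢ univ) :=
    (continuous_rot.comp continuous_snd).continuousOn
  have hk1 : ContDiffOn ℝ 1 (fderiv ℝ k) (ball 0 1) :=
    hk.fderiv_of_isOpen isOpen_ball (by norm_num)
  have hg₂ : ContinuousOn (fun p : ℂ × ℝ => g p.2 • ContinuousLinearMap.id ℝ ℂ)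
      (ball (0 : ℂ) 1 ×ˢ univ) := hg'.smul continuousOn_const
  exact ((ContinuousLinearMap.compL ℝ ℂ ℂ ℂ).flip.continuous.comp_continuousOn hr').clm_comp
    (((ContinuousLinearMap.compL ℝ ℂ ℂ ℂ).continuous.comp_continuousOn hg₂).clm_comp
      ((continuousOn_comp_rot
        (hk1.continuousOn_fderiv_of_isOpen isOpen_ball (by norm_num))).clm_comp hr'))

theorem hasFDerivAt_rotAverage (hk : ContDiffOn ℝ 2 k (ball 0 1)) (hg : Continuous g) {z : ℂ}
    (hz : z ∈ ball (0 : ℂ) 1) :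
    HasFDerivAt (rotAverage k g) (∫ t in (0 : ℝ)..(2 * Real.pi), rotIntegrand₁ k g z t) z := by
  have hg' : ContinuousOn (fun p : ℂ × ℝ => g p.2) (ball (0 : ℂ) 1 ×ˢ univ) := by fun_prop
  refine hasFDerivAt_integral_of_continuousOn_prod isOpen_ball 0 (2 * Real.pi)
    (G := fun z t => g t • k (rot t z)) (G' := rotIntegrand₁ k g)
    (hg'.smul (continuousOn_comp_rot hk.continuousOn)) (continuousOn_rotIntegrand₁ hk hg) ?_ hz
  intro x hx t
  have : DifferentiableAt ℝ k (rot t x) := (hk.contDiffAt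
    (isOpen_ball.mem_nhds (rot_mem_ball hx))).differentiableAt (by norm_num)
  exact (this.hasFDerivAt.comp x (rot t).hasFDerivAt).const_smul (g t)

theorem hasFDerivAt_integral_rotIntegrand₁ (hk : ContDiffOn ℝ 2 k (ball 0 1)) (hg : Continuous g)
    {z : ℂ} (hz : z ∈ ball (0 : ℂ) 1) :
    HasFDerivAt (fun z => ∫ t in (0 : ℝ)..(2 * Real.pi), rotIntegrand₁ k g z t)
      (∫ t in (0 : ℝ)..(2 * Real.pi), rotIntegrand₂ k g z t) z := by
  refine hasFDerivAt_integral_of_continuousOn_prod isOpen_ball 0 (2 * Real.pi)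
    (continuousOn_rotIntegrand₁ hk hg) (continuousOn_rotIntegrand₂ hk hg) ?_ hz
  intro x hx t
  have hk1 : ContDiffOn ℝ 1 (fderiv ℝ k) (ball 0 1) :=
    hk.fderiv_of_isOpen isOpen_ball (by norm_num)
  have : DifferentiableAt ℝ (fderiv ℝ k) (rot t x) := (hk1.contDiffAt
    (isOpen_ball.mem_nhds (rot_mem_ball hx))).differentiableAt (by norm_num)
  exact (((ContinuousLinearMap.compL ℝ ℂ ℂ ℂ).flip (rot t)).hasFDerivAt).comp x
    ((ContinuousLinearMap.compL ℝ ℂ ℂ ℂ (g t • ContinuousLinearMap.id ℝ ℂ)).hasFDerivAt.comp x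
      (this.hasFDerivAt.comp x (rot t).hasFDerivAt))

theorem fderiv_rotAverage (hk : ContDiffOn ℝ 2 k (ball 0 1)) (hg : Continuous g) {z : ℂ}
    (hz : z ∈ ball (0 : ℂ) 1) :
    fderiv ℝ (rotAverage k g) z = ∫ t in (0 : ℝ)..(2 * Real.pi), rotIntegrand₁ k g z t :=
  (hasFDerivAt_rotAverage hk hg hz).fderiv

theorem hasFDerivAt_fderiv_rotAverage (hk : ContDiffOn ℝ 2 k (ball 0 1)) (hg : Continuous g)
    {z : ℂ} (hz : z ∈ ball (0 : ℂ) 1) :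
    HasFDerivAt (fderiv ℝ (rotAverage k g))
      (∫ t in (0 : ℝ)..(2 * Real.pi), rotIntegrand₂ k g z t) z := by
  refine (hasFDerivAt_integral_rotIntegrand₁ hk hg hz).congr_of_eventuallyEq ?_
  filter_upwards [isOpen_ball.mem_nhds hz] with w hw using fderiv_rotAverage hk hg hw

theorem contDiffOn_rotAverage (hk : ContDiffOn ℝ 2 k (ball 0 1)) (hg : Continuous g) :
    ContDiffOn ℝ 2 (rotAverage k g) (ball 0 1) := by
  rw [show (2 : WithTop ℕ∞) = 1 + 1 by norm_num, contDiffOn_succ_iff_fderiv_of_isOpen isOpen_ball]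
  refine ⟨fun z hz => (hasFDerivAt_rotAverage hk hg hz).differentiableAt.differentiableWithinAt,
    by simp, ?_⟩
  rw [show (1 : WithTop ℕ∞) = 0 + 1 by norm_num, contDiffOn_succ_iff_fderiv_of_isOpen isOpen_ball]
  refine ⟨fun z hz =>
    (hasFDerivAt_fderiv_rotAverage hk hg hz).differentiableAt.differentiableWithinAt,
    by simp, ?_⟩
  rw [contDiffOn_zero]
  exact (continuousOn_integral_of_continuousOn_prod isOpen_ball 0 (2 * Real.pi)
    (continuousOn_rotIntegrand₂ hk hg)).congr
    fun z hz => (hasFDerivAt_fderiv_rotAverage hk hg hz).fderiv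

/-- The trace of a bilinear form does not depend on the orthonormal basis; the cross terms cancel
without symmetry of `B`. For a Hessian this is the rotation invariance of the Laplacian. -/
theorem bilin_rot_add (B : ℂ →L[ℝ] ℂ →L[ℝ] ℂ) (t : ℝ) :
    B (rot t 1) (rot t 1) + B (rot t Complex.I) (rot t Complex.I)
      = B 1 1 + B Complex.I Complex.I := by
  obtain ⟨a, b, h, hab⟩ : ∃ a b : ℝ, (Circle.exp (-t) : ℂ) = a + b * Complex.I ∧
      a ^ 2 + b ^ 2 = 1 := by
    refine ⟨(Circle.exp (-t) : ℂ).re, (Circle.exp (-t) : ℂ).im, (Complex.re_add_im _).symm, ?_⟩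
    have := Circle.normSq_coe (Circle.exp (-t))
    rw [Complex.normSq_apply] at this
    linarith
  have h1 : rot t 1 = a • (1 : ℂ) + b • Complex.I := by
    rw [rot_apply, h]; simp
  have hI : rot t Complex.I = (-b) • (1 : ℂ) + a • Complex.I := by
    simp only [rot_apply, h, Complex.real_smul]
    push_cast
    linear_combination (b : ℂ) * Complex.I_sq
  have hab' : (a : ℂ) ^ 2 + (b : ℂ) ^ 2 = 1 := by exact_mod_cast hab
  rw [h1, hI]
  simp only [map_add, map_smul, add_apply, smul_apply]
  simp only [Complex.real_smul]
  push_cast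
  linear_combination (B 1 1 + B Complex.I Complex.I) * hab'

/-- `|z|²`, the Laplacian and the radial derivative all commute with rotations, so `L` passes under
the integral sign. -/
theorem L_rotAverage (α : ℝ) (hk : ContDiffOn ℝ 2 k (ball 0 1)) (hg : Continuous g) {z : ℂ}
    (hz : z ∈ ball (0 : ℂ) 1) :
    L α (rotAverage k g) z = ∫ t in (0 : ℝ)..(2 * Real.pi), g t * L α k (rot t z) := by
  have i2 := (continuous_slice (continuousOn_rotIntegrand₂ hk hg) hz)
  have i1 := (continuous_slice (continuousOn_rotIntegrand₁ hk hg) hz)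
  have i0 : Continuous fun t => g t • k (rot t z) := hg.smul
    (continuous_slice (G := fun z t => k (rot t z)) (continuousOn_comp_rot hk.continuousOn) hz)
  have e2 : ∀ v : ℂ, fderiv ℝ (fderiv ℝ (rotAverage k g)) z v v
      = ∫ t in (0 : ℝ)..(2 * Real.pi), rotIntegrand₂ k g z t v v := by
    intro v
    rw [(hasFDerivAt_fderiv_rotAverage hk hg hz).fderiv,
      ContinuousLinearMap.intervalIntegral_apply (i2.intervalIntegrable _ _),
      ContinuousLinearMap.intervalIntegral_apply
        ((i2.clm_apply continuous_const).intervalIntegrable _ _)]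
  have c2 : ∀ v : ℂ, Continuous fun t => rotIntegrand₂ k g z t v v := fun v =>
    (i2.clm_apply continuous_const).clm_apply continuous_const
  have e1 : fderiv ℝ (rotAverage k g) z z
      = ∫ t in (0 : ℝ)..(2 * Real.pi), rotIntegrand₁ k g z t z := by
    rw [fderiv_rotAverage hk hg hz,
      ContinuousLinearMap.intervalIntegral_apply (i1.intervalIntegrable _ _)]
  have c1 : Continuous fun t => rotIntegrand₁ k g z t z := i1.clm_apply continuous_const
  have ii : ∀ {h : ℝ → ℂ}, Continuous h →
      IntervalIntegrable h MeasureTheory.volume 0 (2 * Real.pi) :=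
    fun hh => hh.intervalIntegrable _ _
  have c3 : Continuous fun t => ((1 - ‖z‖ ^ 2 : ℝ) : ℂ) * (rotIntegrand₂ k g z t 1 1
      + rotIntegrand₂ k g z t Complex.I Complex.I) := ((c2 _).add (c2 _)).const_mul _
  have c4 : Continuous fun t => ((2 * α : ℝ) : ℂ) * rotIntegrand₁ k g z t z := c1.const_mul _
  have c5 : Continuous fun t => ((1 - ‖z‖ ^ 2 : ℝ) : ℂ) * (rotIntegrand₂ k g z t 1 1
      + rotIntegrand₂ k g z t Complex.I Complex.I)
      + ((2 * α : ℝ) : ℂ) * rotIntegrand₁ k g z t z := c3.add c4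
  rw [L, e2, e2, e1, rotAverage, ← intervalIntegral.integral_add (ii (c2 _)) (ii (c2 _)),
    ← intervalIntegral.integral_const_mul, ← intervalIntegral.integral_const_mul,
    ← intervalIntegral.integral_const_mul, ← intervalIntegral.integral_add (ii c3) (ii c4),
    ← intervalIntegral.integral_sub (ii c5) (ii (i0.const_mul _))]
  congr 1
  ext t
  have hb := bilin_rot_add (fderiv ℝ (fderiv ℝ k) (rot t z)) t
  simp only [L, rotIntegrand₂, rotIntegrand₁, norm_rot_apply, smul_eq_mul,
    smul_apply, ContinuousLinearMap.comp_apply, ContinuousLinearMap.flip_apply,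
    ContinuousLinearMap.compL_apply, ContinuousLinearMap.id_apply]
  rw [← hb]
  ring

/-- Rotation averages of `α`-harmonic functions are `α`-harmonic. -/
theorem IsAlphaHarmonic.rotAverage {α : ℝ} (hk : IsAlphaHarmonic α k) (hg : Continuous g) :
    IsAlphaHarmonic α (rotAverage k g) := by
  refine ⟨contDiffOn_rotAverage hk.contDiffOn hg, fun z hz => ?_⟩
  rw [T_eq_zero_iff α _ hz, L_rotAverage α hk.contDiffOn hg hz]
  have : ∀ t, L α k (rot t z) = 0 := fun t =>
    (T_eq_zero_iff α k (rot_mem_ball hz)).1 (hk.eq_zero _ (rot_mem_ball hz))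
  simp [this]

end RotAverage

/-! ### The kernel is α-harmonic. -/

theorem norm_one_sub_pos {z : ℂ} (hz : z ∈ ball (0 : ℂ) 1) : 0 < ‖1 - z‖ := by
  rw [norm_pos_iff, sub_ne_zero]
  rintro rfl
  simp at hz

theorem one_sub_norm_sq_pos {z : ℂ} (hz : z ∈ ball (0 : ℂ) 1) : 0 < 1 - ‖z‖ ^ 2 := by
  have : ‖z‖ < 1 := by simpa using hz
  nlinarith [norm_nonneg z]

theorem contDiffOn_kernel (α : ℝ) :
    ContDiffOn ℝ 2 (fun z => (kernel α z : ℂ)) (ball 0 1) := by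
  intro z hz
  refine ContDiffAt.contDiffWithinAt ?_
  refine Complex.ofRealCLM.contDiff.contDiffAt.comp z ?_
  have h1 : ContDiffAt ℝ 2 (fun z : ℂ => (1 - ‖z‖ ^ 2) ^ (α + 1)) z :=
    (contDiffAt_const.sub (contDiff_norm_sq ℝ).contDiffAt).rpow_const_of_ne
      (one_sub_norm_sq_pos hz).ne'
  have h2 : ContDiffAt ℝ 2 (fun z : ℂ => ‖1 - z‖ ^ (α + 2)) z :=
    ((contDiffAt_const.sub contDiffAt_id).norm ℝ
      (norm_pos_iff.1 (norm_one_sub_pos hz))).rpow_const_of_ne (norm_one_sub_pos hz).ne'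
  exact contDiffAt_const.mul (h1.div h2
    (Real.rpow_pos_of_pos (norm_one_sub_pos hz) _).ne')

/-- Both bases, `1 - |z|²` and `|1 - z|²`, are now quadratic polynomials along every real line. -/
theorem kernel_eq (α : ℝ) (z : ℂ) :
    kernel α z = Real.Gamma (α / 2 + 1) ^ 2 / Real.Gamma (1 + α)
      * ((1 - ‖z‖ ^ 2) ^ (α + 1) * (‖1 - z‖ ^ 2) ^ (-(α / 2 + 1))) := by
  rw [kernel, Real.rpow_neg (by positivity), ← Real.rpow_natCast_mul (norm_nonneg _),
    div_eq_mul_inv ((1 - ‖z‖ ^ 2) ^ (α + 1))]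
  congr 4
  push_cast
  ring

theorem hasDerivAt_quadratic (c₀ c₁ c₂ s : ℝ) :
    HasDerivAt (fun s : ℝ => c₀ + c₁ * s + c₂ * s ^ 2) (c₁ + 2 * c₂ * s) s := by
  have := (((hasDerivAt_id s).const_mul c₁).const_add c₀).add
    (((hasDerivAt_id s).pow 2).const_mul c₂)
  refine this.congr_deriv ?_
  simp
  ring

theorem hasDerivAt_affine (c₀ c₁ s : ℝ) : HasDerivAt (fun s : ℝ => c₀ + c₁ * s) c₁ s := by
  simpa using ((hasDerivAt_id s).const_mul c₁).const_add c₀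

/-- The derivative is written with products of the same shape and lowered exponents, so that the
rule can be applied a second time. -/
theorem hasDerivAt_rpow_mul_rpow {a b : ℝ → ℝ} {a' b' s : ℝ} (ha : HasDerivAt a a' s)
    (hb : HasDerivAt b b' s) (ha0 : a s ≠ 0) (hb0 : b s ≠ 0) (p q : ℝ) :
    HasDerivAt (fun s => a s ^ p * b s ^ q)
      (a' * (p * (a s ^ (p - 1) * b s ^ q)) + b' * (q * (a s ^ p * b s ^ (q - 1)))) s := by
  refine ((ha.rpow_const (Or.inl ha0)).mul (hb.rpow_const (Or.inl hb0))).congr_deriv ?_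
  ring

/-- First and second derivatives of the kernel along a line on which `1 - |z|²` and `|1 - z|²`
are the given quadratic polynomials. -/
theorem kernel_line_derivs (α : ℝ) {z v : ℂ} (hz : z ∈ ball (0 : ℂ) 1) {a b a₁ b₁ : ℝ}
    (ha : ∀ s : ℝ, 1 - ‖z + s • v‖ ^ 2 = a + a₁ * s + (-1) * s ^ 2)
    (hb : ∀ s : ℝ, ‖1 - (z + s • v)‖ ^ 2 = b + b₁ * s + 1 * s ^ 2) :
    fderiv ℝ (fun z => (kernel α z : ℂ)) z v
        = ((kernel α z * ((α + 1) * a₁ / a - (α / 2 + 1) * b₁ / b) : ℝ) : ℂ) ∧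
      fderiv ℝ (fderiv ℝ (fun z => (kernel α z : ℂ))) z v v
        = ((kernel α z * ((α + 1) * α * a₁ ^ 2 / a ^ 2 - 2 * (α + 1) / a
          - 2 * (α + 1) * (α / 2 + 1) * a₁ * b₁ / (a * b)
          + (α / 2 + 1) * (α / 2 + 2) * b₁ ^ 2 / b ^ 2 - 2 * (α / 2 + 1) / b) : ℝ) : ℂ) := by
  have ha0 : a = 1 - ‖z‖ ^ 2 := by simpa using (ha 0).symm
  have hb0 : b = ‖1 - z‖ ^ 2 := by simpa using (hb 0).symm
  have hap : 0 < a := by rw [ha0]; exact one_sub_norm_sq_pos hz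
  have hbp : 0 < b := by rw [hb0]; exact pow_pos (norm_one_sub_pos hz) 2
  set p := α + 1 with hp
  set q := -(α / 2 + 1) with hq
  set c := Real.Gamma (α / 2 + 1) ^ 2 / Real.Gamma (1 + α) with hc
  set A : ℝ → ℝ := fun s => a + a₁ * s + (-1) * s ^ 2 with hA
  set B : ℝ → ℝ := fun s => b + b₁ * s + 1 * s ^ 2 with hB
  have hA' : ∀ s, HasDerivAt A (a₁ + 2 * (-1) * s) s := hasDerivAt_quadratic a a₁ (-1)
  have hB' : ∀ s, HasDerivAt B (b₁ + 2 * 1 * s) s := hasDerivAt_quadratic b b₁ 1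
  have hA0 : A 0 = a := by simp [hA]
  have hB0 : B 0 = b := by simp [hB]
  have hk : ∀ s : ℝ, kernel α (z + s • v) = c * (A s ^ p * B s ^ q) := by
    intro s
    rw [kernel_eq, ha, hb]
  have hkz : kernel α z = c * (a ^ p * b ^ q) := by
    rw [kernel_eq, ← ha0, ← hb0]
  have hpos : ∀ᶠ s in 𝓝 (0 : ℝ), A s ≠ 0 ∧ B s ≠ 0 := by
    have h1 := (hA' 0).continuousAt.eventually_ne (by rw [hA0]; exact hap.ne')
    have h2 := (hB' 0).continuousAt.eventually_ne (by rw [hB0]; exact hbp.ne')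
    exact h1.and h2
  have hu : ContDiffAt ℝ 2 (fun z => (kernel α z : ℂ)) z :=
    (contDiffOn_kernel α).contDiffAt (isOpen_ball.mem_nhds hz)
  set D : ℝ → ℝ := fun s => c * ((a₁ + 2 * (-1) * s) * (p * (A s ^ (p - 1) * B s ^ q))
    + (b₁ + 2 * 1 * s) * (q * (A s ^ p * B s ^ (q - 1)))) with hD
  have h1 : ∀ᶠ s : ℝ in 𝓝 0,
      HasDerivAt (fun s : ℝ => (kernel α (z + s • v) : ℂ)) ((D s : ℝ) : ℂ) s := by
    filter_upwards [hpos] with s hs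
    simp only [hk]
    exact ((hasDerivAt_rpow_mul_rpow (hA' s) (hB' s) hs.1 hs.2 p q).const_mul c).ofReal_comp
  have hn := hpos.self_of_nhds
  have h2 := ((((hasDerivAt_affine a₁ (2 * (-1)) 0).mul
    ((hasDerivAt_rpow_mul_rpow (hA' 0) (hB' 0) hn.1 hn.2 (p - 1) q).const_mul p)).add
    ((hasDerivAt_affine b₁ (2 * 1) 0).mul
    ((hasDerivAt_rpow_mul_rpow (hA' 0) (hB' 0) hn.1 hn.2 p (q - 1)).const_mul q))).const_mul
      c).ofReal_comp
  rw [fderiv_eq_of_line hu h1, fderiv_fderiv_eq_of_line hu h1 h2]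
  constructor
  · congr 1
    simp only [hD, hA0, hB0, hkz, Real.rpow_sub_one hap.ne', Real.rpow_sub_one hbp.ne']
    field_simp
    rw [hq]
    ring
  · congr 1
    simp only [hA0, hB0, hkz, Real.rpow_sub_one hap.ne', Real.rpow_sub_one hbp.ne']
    field_simp
    rw [hq, hp]
    ring

theorem isAlphaHarmonic_kernel (α : ℝ) : IsAlphaHarmonic α fun z => (kernel α z : ℂ) := by
  refine ⟨contDiffOn_kernel α, fun z hz => ?_⟩
  rw [T_eq_zero_iff α _ hz]
  have hA := one_sub_norm_sq_pos hz
  have hB : 0 < ‖1 - z‖ ^ 2 := pow_pos (norm_one_sub_pos hz) 2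
  have eA : ‖z‖ ^ 2 = z.re ^ 2 + z.im ^ 2 := by
    rw [← Complex.normSq_eq_norm_sq, Complex.normSq_apply]; ring
  have eB : ‖1 - z‖ ^ 2 = (1 - z.re) ^ 2 + z.im ^ 2 := by
    rw [← Complex.normSq_eq_norm_sq, Complex.normSq_apply]
    simp
    ring
  obtain ⟨d1, dd1⟩ := kernel_line_derivs α (v := 1) hz (a := 1 - ‖z‖ ^ 2) (b := ‖1 - z‖ ^ 2)
    (a₁ := -2 * z.re) (b₁ := -2 * (1 - z.re))
    (fun s => by
      rw [eA, ← Complex.normSq_eq_norm_sq, Complex.normSq_apply]; simp; ring)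
    (fun s => by
      rw [eB, ← Complex.normSq_eq_norm_sq, Complex.normSq_apply]; simp; ring)
  obtain ⟨d2, dd2⟩ := kernel_line_derivs α (v := Complex.I) hz (a := 1 - ‖z‖ ^ 2)
    (b := ‖1 - z‖ ^ 2) (a₁ := -2 * z.im) (b₁ := 2 * z.im)
    (fun s => by
      rw [eA, ← Complex.normSq_eq_norm_sq, Complex.normSq_apply]; simp; ring)
    (fun s => by
      rw [eB, ← Complex.normSq_eq_norm_sq, Complex.normSq_apply]; simp; ring)
  -- Every term carries the factor `kernel α z`; what remains is a rational identity in the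
  -- coordinates of `z`.
  rw [L, fderiv_apply_self, d1, d2, dd1, dd2]
  simp only [Complex.real_smul, ← Complex.ofReal_mul, ← Complex.ofReal_add,
    ← Complex.ofReal_sub, Complex.ofReal_eq_zero]
  rw [eB] at hB ⊢
  rw [eA] at hA ⊢
  field_simp
  ring

/-! ### The normalizing constant. -/

theorem integrable_one_add_sq_rpow {p : ℝ} (hp : 1 / 2 < p) :
    Integrable fun y : ℝ => (1 + y ^ 2) ^ (-p) := by
  have h := integrable_rpow_neg_one_add_norm_sq (E := ℝ) (μ := volume) (r := 2 * p)
    (by simp; linarith)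
  convert h using 3 with y
  · simp
  · ring

/-- Integrating the Gaussian in `y` first leaves a multiple of `x^(p - 3/2) e^(-x)`, integrable at 0
exactly because `p > 1/2`. -/
theorem integrable_gamma_gaussian {p : ℝ} (hp : 1 / 2 < p) :
    Integrable (Function.uncurry fun x y : ℝ => x ^ (p - 1) * Real.exp (-((1 + y ^ 2) * x)))
      ((volume.restrict (Ioi 0)).prod volume) := by
  have hmeas : Measurable
      (Function.uncurry fun x y : ℝ => x ^ (p - 1) * Real.exp (-((1 + y ^ 2) * x))) := by
    unfold Function.uncurry
    fun_prop
  have hsplit : ∀ x y : ℝ, Real.exp (-((1 + y ^ 2) * x))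
      = Real.exp (-x) * Real.exp (-x * y ^ 2) := by
    intro x y
    rw [← Real.exp_add]
    ring_nf
  refine (integrable_prod_iff hmeas.aestronglyMeasurable).2 ⟨?_, ?_⟩
  · filter_upwards [ae_restrict_mem measurableSet_Ioi] with x hx
    simp only [Function.uncurry_apply_pair, hsplit]
    exact ((integrable_exp_neg_mul_sq hx).const_mul _).const_mul _
  · have := (Real.GammaIntegral_convergent (s := p - 1 / 2) (by linarith)).const_mul √Real.pi
    refine this.congr ?_
    filter_upwards [ae_restrict_mem measurableSet_Ioi] with x hx
    have hx : 0 < x := hx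
    simp only [Function.uncurry_apply_pair, hsplit, norm_mul, Real.norm_eq_abs, Real.abs_exp,
      abs_of_pos (Real.rpow_pos_of_pos hx _)]
    rw [integral_const_mul, integral_const_mul, integral_gaussian, Real.sqrt_div' _ hx.le,
      Real.sqrt_eq_rpow x, show p - 1 / 2 - 1 = (p - 1) - 1 / 2 by ring, Real.rpow_sub hx (p - 1)]
    ring

/-- Expand `Γ(p) (1 + y²)^(-p)` as a Gamma integral in `x` and swap: the inner integral becomes
Gaussian and the outer one gives `Γ(p - 1/2)`. -/
theorem integral_one_add_sq_rpow {p : ℝ} (hp : 1 / 2 < p) :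
    ∫ y : ℝ, (1 + y ^ 2) ^ (-p) = √Real.pi * Real.Gamma (p - 1 / 2) / Real.Gamma p := by
  have hswap := integral_integral_swap (integrable_gamma_gaussian hp)
  have hl : ∫ x in Ioi (0 : ℝ), ∫ y : ℝ, x ^ (p - 1) * Real.exp (-((1 + y ^ 2) * x))
      = √Real.pi * Real.Gamma (p - 1 / 2) := by
    rw [Real.Gamma_eq_integral (by linarith), ← integral_const_mul]
    refine setIntegral_congr_fun measurableSet_Ioi fun x hx => ?_
    have hx : 0 < x := hx
    have hsplit : ∀ y : ℝ, Real.exp (-((1 + y ^ 2) * x))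
        = Real.exp (-x) * Real.exp (-x * y ^ 2) := by
      intro y
      rw [← Real.exp_add]
      ring_nf
    simp only [hsplit]
    rw [integral_const_mul, integral_const_mul, integral_gaussian, Real.sqrt_div' _ hx.le,
      Real.sqrt_eq_rpow x, show p - 1 / 2 - 1 = (p - 1) - 1 / 2 by ring, Real.rpow_sub hx (p - 1)]
    ring
  have hr : ∀ y : ℝ, ∫ x in Ioi (0 : ℝ), x ^ (p - 1) * Real.exp (-((1 + y ^ 2) * x))
      = (1 + y ^ 2) ^ (-p) * Real.Gamma p := by
    intro y
    rw [Real.integral_rpow_mul_exp_neg_mul_Ioi (by linarith) (by positivity), one_div,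
      Real.inv_rpow (by positivity), Real.rpow_neg (by positivity)]
  simp only [hr] at hswap
  rw [hl, integral_mul_const] at hswap
  rw [hswap, mul_div_cancel_right₀ _ (Real.Gamma_pos_of_pos (by linarith)).ne']

/-- The left side is the limit, as `r → 1`, of the mean of the kernel over the circle of radius `r`.
It equals 1 by the duplication formula at `(α + 1)/2`. -/
theorem kernel_normalization {α : ℝ} (hα : -1 < α) :
    Real.Gamma (α / 2 + 1) ^ 2 / Real.Gamma (1 + α) * (2 ^ α / Real.pi)
      * ∫ y : ℝ, (1 + y ^ 2) ^ (-(α / 2 + 1)) = 1 := by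
  have hd := Real.Gamma_mul_Gamma_add_half ((α + 1) / 2)
  rw [show (α + 1) / 2 + 1 / 2 = α / 2 + 1 by ring, show 2 * ((α + 1) / 2) = 1 + α by ring,
    show 1 - (1 + α) = -α by ring, Real.rpow_neg (by norm_num)] at hd
  rw [integral_one_add_sq_rpow (by linarith), show α / 2 + 1 - 1 / 2 = (α + 1) / 2 by ring]
  have h1 : 0 < Real.Gamma (α / 2 + 1) := Real.Gamma_pos_of_pos (by linarith)
  have h2 : 0 < Real.Gamma (1 + α) := Real.Gamma_pos_of_pos (by linarith)
  have h3 : (0 : ℝ) < 2 ^ α := by positivity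
  have hpi := Real.pi_pos
  have hsq := Real.sq_sqrt hpi.le
  have hspos := Real.sqrt_pos.2 hpi
  have hG : Real.Gamma ((α + 1) / 2)
      = Real.Gamma (1 + α) * (2 ^ α)⁻¹ * √Real.pi / Real.Gamma (α / 2 + 1) := by
    rw [eq_div_iff h1.ne', hd]
  rw [hG]
  generalize Real.Gamma (α / 2 + 1) = G at h1
  field_simp
  exact hsq

/-! ### Boundary limit of the Poisson type integral. -/

/-- With `tan(s/2) = ρ y`, the expression `(1 - r)² + 4r sin²(s/2)` is proportional to `(1 - r)² +
(1 + r)² ρ² y²`. The choice of `ρ` makes the two summands share the factor `(1 - r)²`. -/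
theorem norm_sq_one_sub_exp (r ρ y : ℝ) (hr : 0 < 1 + r) (hρ : ρ = (1 - r) / (1 + r)) :
    ‖1 - (r : ℂ) * (Circle.exp (-(2 * Real.arctan (ρ * y))) : ℂ)‖ ^ 2
      = (1 - r) ^ 2 * (1 + y ^ 2) / (1 + ρ ^ 2 * y ^ 2) := by
  have hexp : ∀ s : ℝ, ‖1 - (r : ℂ) * (Circle.exp (-s) : ℂ)‖ ^ 2
      = 1 - 2 * r * Real.cos s + r ^ 2 := by
    intro s
    rw [← Complex.normSq_eq_norm_sq, Complex.normSq_apply, Circle.coe_exp]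
    simp only [Complex.sub_re, Complex.sub_im, Complex.re_ofReal_mul, Complex.im_ofReal_mul,
      Complex.exp_ofReal_mul_I_re, Complex.exp_ofReal_mul_I_im, Complex.one_re, Complex.one_im,
      Real.cos_neg, Real.sin_neg]
    linear_combination r ^ 2 * Real.sin_sq_add_cos_sq s
  have hpos : 0 < 1 + (ρ * y) ^ 2 := by positivity
  rw [hexp, Real.cos_two_mul, Real.cos_sq_arctan, eq_div_iff (by rw [← mul_pow]; exact hpos.ne'),
    ← mul_pow]
  field_simp
  rw [hρ]
  field_simp
  ring

/-- The Jacobian contributes the one power of `1 - r` needed to cancel the exponents `α + 1` and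
`-(α + 2)`; the right side stays regular as `r → 1`. -/
theorem kernel_mul_deriv (α : ℝ) {r ρ : ℝ} (hr0 : 0 < r) (hr1 : r < 1)
    (hρ : ρ = (1 - r) / (1 + r)) (y : ℝ) :
    2 * ρ / (1 + ρ ^ 2 * y ^ 2)
        * kernel α ((r : ℂ) * (Circle.exp (-(2 * Real.arctan (ρ * y))) : ℂ))
      = 2 * (Real.Gamma (α / 2 + 1) ^ 2 / Real.Gamma (1 + α)) * (1 + r) ^ α
        * ((1 + y ^ 2) ^ (-(α / 2 + 1)) * (1 + ρ ^ 2 * y ^ 2) ^ (α / 2)) := by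
  have h1 : 0 < 1 - r := by linarith
  have h2 : 0 < 1 + r := by linarith
  have hD : 0 < 1 + ρ ^ 2 * y ^ 2 := by positivity
  have hY : 0 < 1 + y ^ 2 := by positivity
  have hnorm : ‖(r : ℂ) * (Circle.exp (-(2 * Real.arctan (ρ * y))) : ℂ)‖ = r := by
    rw [norm_mul, Circle.norm_coe, mul_one, Complex.norm_real, Real.norm_of_nonneg hr0.le]
  have e2 : ((1 - r) ^ 2) ^ (-(α / 2 + 1)) = ((1 - r) ^ (α + 1))⁻¹ * (1 - r)⁻¹ := by
    rw [← Real.rpow_natCast_mul h1.le, ← Real.rpow_neg h1.le, ← Real.rpow_neg_one (1 - r),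
      ← Real.rpow_add h1]
    congr 1
    push_cast
    ring
  rw [kernel_eq, norm_sq_one_sub_exp r ρ y h2 hρ, hnorm,
    Real.div_rpow (by positivity) hD.le, Real.mul_rpow (by positivity) hY.le, e2,
    Real.rpow_neg hD.le (α / 2 + 1), Real.rpow_add_one hD.ne' (α / 2),
    show (1 - r ^ 2) = (1 - r) * (1 + r) by ring, Real.mul_rpow h1.le h2.le,
    Real.rpow_add_one h2.ne']
  have := Real.rpow_pos_of_pos h1 (α + 1)
  rw [hρ]
  field_simp

theorem image_two_arctan {ρ : ℝ} (hρ : 0 < ρ) :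
    (fun y : ℝ => 2 * Real.arctan (ρ * y)) '' univ = Ioo (-Real.pi) Real.pi := by
  ext s
  simp only [image_univ, mem_range, mem_Ioo]
  constructor
  · rintro ⟨y, rfl⟩
    have h1 := Real.arctan_lt_pi_div_two (ρ * y)
    have h2 := Real.neg_pi_div_two_lt_arctan (ρ * y)
    constructor <;> linarith
  · rintro ⟨h1, h2⟩
    refine ⟨Real.tan (s / 2) / ρ, ?_⟩
    rw [mul_div_cancel₀ _ hρ.ne', Real.arctan_tan (by linarith) (by linarith)]
    ring

theorem integral_eq_integral_two_arctan {ρ : ℝ} (hρ : 0 < ρ) (h : ℝ → ℂ) :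
    ∫ s in (-Real.pi)..Real.pi, h s
      = ∫ y : ℝ, (2 * ρ / (1 + ρ ^ 2 * y ^ 2)) • h (2 * Real.arctan (ρ * y)) := by
  have hd : ∀ y ∈ (univ : Set ℝ), HasDerivWithinAt (fun y : ℝ => 2 * Real.arctan (ρ * y))
      (2 * ρ / (1 + ρ ^ 2 * y ^ 2)) univ y := by
    intro y _
    have := ((((hasDerivAt_id y).const_mul ρ).arctan).const_mul 2).hasDerivWithinAt (s := univ)
    refine this.congr_deriv ?_
    simp only [id, mul_one, mul_pow]
    ring
  have hinj : InjOn (fun y : ℝ => 2 * Real.arctan (ρ * y)) univ := by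
    intro x _ y _ hxy
    have : Real.arctan (ρ * x) = Real.arctan (ρ * y) := by
      simpa using hxy
    exact mul_left_cancel₀ hρ.ne' (Real.arctan_injective this)
  have := integral_image_eq_integral_abs_deriv_smul MeasurableSet.univ hd hinj h
  rw [image_two_arctan hρ, setIntegral_univ] at this
  rw [intervalIntegral.integral_of_le (by linarith [Real.pi_pos]), integral_Ioc_eq_integral_Ioo,
    this]
  congr 1
  ext y
  rw [abs_of_pos (by positivity)]

/-- Rotating the variable by periodicity puts the peak of the kernel at `s = 0`, away from the
endpoints. -/
theorem poisson_shift (α : ℝ) (f : Circle → ℂ) (r : ℝ) (ζ : Circle) :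
    poisson α f (r * ζ) = 1 / (2 * (Real.pi : ℂ)) * ∫ s in (-Real.pi)..Real.pi,
      (kernel α (r * (Circle.exp (-s) : ℂ)) : ℂ) * f (ζ * Circle.exp s) := by
  obtain ⟨θ, rfl⟩ : ∃ θ, Circle.exp θ = ζ := ⟨_, Circle.exp_arg ζ⟩
  set h : ℝ → ℂ := fun t => (kernel α (r * Circle.exp θ * (Circle.exp (-t) : ℂ)) : ℂ)
    * f (Circle.exp t) with hh
  have hper : Function.Periodic h (2 * Real.pi) := by
    intro t
    have h2 : Circle.exp (-(t + 2 * Real.pi)) = Circle.exp (-t) := by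
      rw [neg_add, ← sub_eq_add_neg, Circle.periodic_exp.sub_eq]
    simp only [hh, Circle.periodic_exp t, h2]
  have e1 := hper.intervalIntegral_add_eq 0 (θ + -Real.pi)
  rw [zero_add, show θ + -Real.pi + 2 * Real.pi = θ + Real.pi by ring,
    ← intervalIntegral.integral_comp_add_left] at e1
  rw [poisson]
  congr 1
  refine e1.trans ?_
  congr 1
  ext s
  have h3 : (Circle.exp θ : ℂ) * (Circle.exp (-(θ + s)) : ℂ) = Circle.exp (-s) := by
    rw [← Circle.coe_mul, ← Circle.exp_add]
    ring_nf
  simp only [hh, mul_assoc, h3, Circle.exp_add]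

theorem poisson_eq_integral_real (α : ℝ) (f : Circle → ℂ) {r ρ : ℝ} (hr0 : 0 < r) (hr1 : r < 1)
    (hρ : ρ = (1 - r) / (1 + r)) (ζ : Circle) :
    poisson α f (r * ζ)
      = ((Real.Gamma (α / 2 + 1) ^ 2 / Real.Gamma (1 + α) * ((1 + r) ^ α / Real.pi) : ℝ) : ℂ)
        * ∫ y : ℝ, (((1 + y ^ 2) ^ (-(α / 2 + 1)) * (1 + ρ ^ 2 * y ^ 2) ^ (α / 2) : ℝ) : ℂ)
          * f (ζ * Circle.exp (2 * Real.arctan (ρ * y))) := by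
  have hρ0 : 0 < ρ := by
    rw [hρ]
    exact div_pos (by linarith) (by linarith)
  rw [poisson_shift, integral_eq_integral_two_arctan hρ0, ← integral_const_mul,
    ← integral_const_mul]
  congr 1
  ext y
  rw [Complex.real_smul, ← mul_assoc, ← mul_assoc, mul_assoc (1 / _), ← Complex.ofReal_mul,
    kernel_mul_deriv α hr0 hr1 hρ]
  have hpi : (Real.pi : ℂ) ≠ 0 := by exact_mod_cast Real.pi_ne_zero
  push_cast
  field_simp

/-- A majorant independent of `ρ`. For `α ≥ 0` the second factor is largest at `ρ = 1`, leaving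
exponent `-1`; for `α < 0` it is at most 1, leaving `-(α/2 + 1)`, integrable when `α > -1`. -/
theorem integrand_bound (α : ℝ) {ρ : ℝ} (hρ0 : 0 ≤ ρ) (hρ1 : ρ ≤ 1) (y : ℝ) :
    (1 + y ^ 2) ^ (-(α / 2 + 1)) * (1 + ρ ^ 2 * y ^ 2) ^ (α / 2)
      ≤ (1 + y ^ 2) ^ (-(α / 2 + 1 - max (α / 2) 0)) := by
  have hy : 0 < 1 + y ^ 2 := by positivity
  have h1 : 1 ≤ 1 + ρ ^ 2 * y ^ 2 := by
    have : 0 ≤ ρ ^ 2 * y ^ 2 := by positivity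
    linarith
  have h2 : 1 + ρ ^ 2 * y ^ 2 ≤ 1 + y ^ 2 := by
    have : ρ ^ 2 ≤ 1 := pow_le_one₀ hρ0 hρ1
    nlinarith [sq_nonneg y]
  have h3 : (1 + ρ ^ 2 * y ^ 2) ^ (α / 2) ≤ (1 + y ^ 2) ^ (max (α / 2) 0) :=
    (Real.rpow_le_rpow_of_exponent_le h1 (le_max_left _ _)).trans
      (Real.rpow_le_rpow (by linarith) h2 (le_max_right _ _))
  calc _ ≤ (1 + y ^ 2) ^ (-(α / 2 + 1)) * (1 + y ^ 2) ^ (max (α / 2) 0) := by gcongr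
    _ = _ := by
      rw [← Real.rpow_add hy]
      congr 1
      ring

/-- The limit is joint in radius and angle, which is what continuity on the closed disk requires.
Since `ρ → 0`, for each fixed `y` the argument of `f` tends to `ζ₀`. -/
theorem tendsto_poisson_polar {α : ℝ} (hα : -1 < α) {f : Circle → ℂ} (hf : Continuous f)
    (ζ₀ : Circle) :
    Tendsto (fun p : ℝ × Circle => poisson α f (p.1 * p.2)) (𝓝[<] 1 ×ˢ 𝓝 ζ₀) (𝓝 (f ζ₀)) := by
  obtain ⟨M, hM⟩ := isCompact_univ.exists_bound_of_continuousOn hf.continuousOn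
  have hM : ∀ ζ, ‖f ζ‖ ≤ M := fun ζ => hM ζ (mem_univ ζ)
  set l : Filter (ℝ × Circle) := 𝓝[<] 1 ×ˢ 𝓝 ζ₀ with hl
  have hr : Tendsto (fun p : ℝ × Circle => p.1) l (𝓝 1) :=
    (tendsto_fst (f := 𝓝[<] (1 : ℝ))).mono_right nhdsWithin_le_nhds
  have hζ : Tendsto (fun p : ℝ × Circle => p.2) l (𝓝 ζ₀) := tendsto_snd
  have hρt : Tendsto (fun p : ℝ × Circle => (1 - p.1) / (1 + p.1)) l (𝓝 0) := by
    have : Tendsto (fun p : ℝ × Circle => (1 - p.1) / (1 + p.1)) l (𝓝 ((1 - 1) / (1 + 1))) :=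
      (hr.const_sub 1).div (hr.const_add 1) (by norm_num)
    simpa using this
  have hev : ∀ᶠ p in l, 0 < p.1 ∧ p.1 < 1 :=
    (hr.eventually (lt_mem_nhds one_pos)).and
      ((tendsto_fst (f := 𝓝[<] (1 : ℝ))).eventually self_mem_nhdsWithin)
  have hdom : Tendsto (fun p : ℝ × Circle => ∫ y : ℝ, (((1 + y ^ 2) ^ (-(α / 2 + 1))
        * (1 + ((1 - p.1) / (1 + p.1)) ^ 2 * y ^ 2) ^ (α / 2) : ℝ) : ℂ)
          * f (p.2 * Circle.exp (2 * Real.arctan ((1 - p.1) / (1 + p.1) * y)))) l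
      (𝓝 (∫ y : ℝ, (((1 + y ^ 2) ^ (-(α / 2 + 1)) : ℝ) : ℂ) * f ζ₀)) := by
    refine tendsto_integral_filter_of_dominated_convergence
      (fun y => (1 + y ^ 2) ^ (-(α / 2 + 1 - max (α / 2) 0)) * M) ?_ ?_ ?_ ?_
    · refine .of_forall fun p => Continuous.aestronglyMeasurable ?_
      have hpos : ∀ (c y : ℝ), 1 + c ^ 2 * y ^ 2 ≠ 0 := fun c y => by positivity
      have hpos' : ∀ (y : ℝ), 1 + y ^ 2 ≠ 0 := fun y => by positivity
      refine (Complex.continuous_ofReal.comp (Continuous.mul ?_ ?_)).mul (hf.comp ?_)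
      · exact Continuous.rpow_const (by fun_prop) fun y => Or.inl (hpos' y)
      · exact Continuous.rpow_const (by fun_prop) fun y => Or.inl (hpos _ y)
      · exact continuous_const.mul (Circle.exp.continuous.comp
          (continuous_const.mul (Real.continuous_arctan.comp (by fun_prop))))
    · filter_upwards [hev] with p hp
      refine .of_forall fun y => ?_
      rw [norm_mul, Complex.norm_real, Real.norm_of_nonneg (by positivity)]
      have h0 : 0 ≤ (1 - p.1) / (1 + p.1) := div_nonneg (by linarith) (by linarith)
      have h1 : (1 - p.1) / (1 + p.1) ≤ 1 := by
        rw [div_le_one (by linarith)]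
        linarith
      exact mul_le_mul (integrand_bound α h0 h1 y) (hM _) (norm_nonneg _) (by positivity)
    · refine (integrable_one_add_sq_rpow ?_).mul_const M
      rcases max_cases (α / 2) 0 with h | h <;> rw [h.1] <;> linarith
    · refine .of_forall fun y => ?_
      refine Tendsto.mul ?_ ?_
      · refine (Complex.continuous_ofReal.tendsto _).comp ?_
        have h1 : Tendsto (fun p : ℝ × Circle => 1 + ((1 - p.1) / (1 + p.1)) ^ 2 * y ^ 2) l
            (𝓝 1) := by
          simpa using ((hρt.pow 2).mul_const (y ^ 2)).const_add 1
        have h2 := (h1.rpow_const (p := α / 2) (Or.inl one_ne_zero)).const_mul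
          ((1 + y ^ 2) ^ (-(α / 2 + 1)))
        simpa using h2
      · refine (hf.tendsto ζ₀).comp ?_
        have hc : Continuous fun x : ℝ => Circle.exp (2 * Real.arctan (x * y)) :=
          Circle.exp.continuous.comp
            (continuous_const.mul (Real.continuous_arctan.comp (by fun_prop)))
        simpa using hζ.mul ((hc.tendsto 0).comp hρt)
  have hc : Tendsto (fun p : ℝ × Circle =>
      ((Real.Gamma (α / 2 + 1) ^ 2 / Real.Gamma (1 + α) * ((1 + p.1) ^ α / Real.pi) : ℝ) : ℂ)) l
      (𝓝 ((Real.Gamma (α / 2 + 1) ^ 2 / Real.Gamma (1 + α) * (2 ^ α / Real.pi) : ℝ) : ℂ)) := by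
    refine (Complex.continuous_ofReal.tendsto _).comp ?_
    have h1 : Tendsto (fun p : ℝ × Circle => 1 + p.1) l (𝓝 2) := by
      simpa [one_add_one_eq_two] using hr.const_add 1
    exact ((h1.rpow_const (Or.inl two_ne_zero)).div_const _).const_mul _
  have hlim := hc.mul hdom
  rw [integral_mul_const, integral_complex_ofReal, ← mul_assoc, ← Complex.ofReal_mul,
    kernel_normalization hα, Complex.ofReal_one, one_mul] at hlim
  refine hlim.congr' ?_
  filter_upwards [hev] with p hp
  rw [poisson_eq_integral_real α f hp.1 hp.2 rfl]

/-! ### Differences of α-harmonic functions and the maximum principle. -/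

variable {α : ℝ} {u v w : ℂ → ℂ} {f : Circle → ℂ}

theorem IsAlphaHarmonic.contDiffAt (hu : IsAlphaHarmonic α u) {z : ℂ}
    (hz : z ∈ ball (0 : ℂ) 1) : ContDiffAt ℝ 2 u z :=
  hu.contDiffOn.contDiffAt (isOpen_ball.mem_nhds hz)

theorem IsAlphaHarmonic.congr (hu : IsAlphaHarmonic α u) (h : EqOn v u (ball 0 1)) :
    IsAlphaHarmonic α v := by
  refine ⟨hu.contDiffOn.congr h, fun z hz => ?_⟩
  have he : v =ᶠ[𝓝 z] u := by
    filter_upwards [isOpen_ball.mem_nhds hz] with y hy using h hy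
  have hL := (T_eq_zero_iff α u hz).1 (hu.eq_zero z hz)
  rw [T_eq_zero_iff α v hz, L, (he.fderiv (𝕜 := ℝ)).fderiv_eq, he.fderiv_eq, he.self_of_nhds]
  exact hL

theorem IsAlphaHarmonic.sub (hu : IsAlphaHarmonic α u) (hv : IsAlphaHarmonic α v) :
    IsAlphaHarmonic α (fun z => u z - v z) := by
  refine ⟨hu.contDiffOn.sub hv.contDiffOn, fun z hz => ?_⟩
  have hLu := (T_eq_zero_iff α u hz).1 (hu.eq_zero z hz)
  have hLv := (T_eq_zero_iff α v hz).1 (hv.eq_zero z hz)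
  have hd : ∀ y ∈ ball (0 : ℂ) 1, fderiv ℝ (fun z => u z - v z) y
      = fderiv ℝ u y - fderiv ℝ v y := fun y hy =>
    fderiv_fun_sub ((hu.contDiffAt hy).differentiableAt (by norm_num))
      ((hv.contDiffAt hy).differentiableAt (by norm_num))
  have hd2 : fderiv ℝ (fderiv ℝ (fun z => u z - v z)) z
      = fderiv ℝ (fderiv ℝ u) z - fderiv ℝ (fderiv ℝ v) z := by
    have he : fderiv ℝ (fun z => u z - v z) =ᶠ[𝓝 z] fun y => fderiv ℝ u y - fderiv ℝ v y := by
      filter_upwards [isOpen_ball.mem_nhds hz] with y hy using hd y hy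
    rw [he.fderiv_eq]
    exact fderiv_fun_sub
      (((hu.contDiffAt hz).fderiv_right (m := 1) (by norm_num)).differentiableAt (by norm_num))
      (((hv.contDiffAt hz).fderiv_right (m := 1) (by norm_num)).differentiableAt (by norm_num))
  rw [T_eq_zero_iff α _ hz]
  rw [L] at hLu hLv ⊢
  rw [hd2, hd z hz]
  simp only [sub_apply]
  linear_combination hLu - hLv

/-- Second derivative test for `Re u + ε |z|²` along the direction `v`. -/
theorem re_derivs_of_isLocalMax {z d : ℂ} (hu : ContDiffAt ℝ 2 u z) {ε m : ℝ}
    (hm : ∀ s : ℝ, ‖z + s • d‖ ^ 2 = ‖z‖ ^ 2 + 2 * m * s + 1 * s ^ 2)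
    (hmax : IsLocalMax (fun y => (u y).re + ε * ‖y‖ ^ 2) z) :
    (fderiv ℝ u z d).re = -(2 * ε * m) ∧ (fderiv ℝ (fderiv ℝ u) z d d).re ≤ -(2 * ε) := by
  have h1 : ∀ᶠ s : ℝ in 𝓝 0,
      HasDerivAt (fun s : ℝ => (u (z + s • d)).re + ε * ‖z + s • d‖ ^ 2)
        ((fderiv ℝ u (z + s • d) d).re + ε * (2 * m + 2 * 1 * s)) s := by
    filter_upwards [eventually_hasDerivAt_line hu d] with s hs
    simp only [hm]
    exact (Complex.reCLM.hasFDerivAt.comp_hasDerivAt s hs).add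
      ((hasDerivAt_quadratic _ _ _ s).const_mul ε)
  have h2 := (Complex.reCLM.hasFDerivAt.comp_hasDerivAt (0 : ℝ)
    (hasDerivAt_fderiv_line (v := d) hu)).add
    ((hasDerivAt_affine (2 * m) (2 * 1) 0).const_mul ε)
  have hmax' : IsLocalMax (fun s : ℝ => (u (z + s • d)).re + ε * ‖z + s • d‖ ^ 2) 0 := by
    have := (tendsto_line z d).eventually hmax
    filter_upwards [this] with s hs
    simpa using hs
  obtain ⟨e1, e2⟩ := second_deriv_nonpos_of_isLocalMax h1 h2 hmax'
  simp only [zero_smul, add_zero, mul_zero, Complex.reCLM_apply] at e1 e2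
  constructor <;> linarith

/-- The maximum principle for `α`-harmonic functions. -/
theorem IsAlphaHarmonic.re_nonpos (hu : IsAlphaHarmonic α u)
    (hb : ∀ ε > 0, ∃ R < 1, ∀ z : ℂ, R ≤ ‖z‖ → ‖z‖ < 1 → (u z).re ≤ ε) {z : ℂ}
    (hz : z ∈ ball (0 : ℂ) 1) : (u z).re ≤ 0 := by
  by_contra! hpos
  obtain ⟨δ, hδ⟩ : ∃ δ, δ = (u z).re / 2 := ⟨_, rfl⟩
  have hδ0 : 0 < δ := by linarith
  obtain ⟨R₀, hR₀, hbd⟩ := hb δ hδ0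
  have hz1 : ‖z‖ < 1 := by simpa using hz
  obtain ⟨R, hR, hR1⟩ := exists_between (max_lt hR₀ hz1)
  have hRz : ‖z‖ < R := (le_max_right _ _).trans_lt hR
  have hRR : R₀ < R := (le_max_left _ _).trans_lt hR
  have hsub : closedBall (0 : ℂ) R ⊆ ball 0 1 := closedBall_subset_ball hR1
  -- For `α ≠ 0` the term `-α² u` is already strictly negative at a positive maximum. For `α = 0`
  -- strictness comes from adding `ε |z|²`; keeping `ε < δ` forces `Re u > δ` at the maximum point,
  -- which excludes `‖x‖ = R`.
  obtain ⟨ε, hε0, hεδ, hε1, hε2⟩ : ∃ ε : ℝ, 0 ≤ ε ∧ ε < δ ∧ (α ≠ 0 → ε = 0) ∧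
      (α = 0 → 0 < ε) := by
    by_cases h : α = 0
    · exact ⟨δ / 2, by linarith, by linarith, fun h' => absurd h h', fun _ => by linarith⟩
    · exact ⟨0, le_rfl, hδ0, fun _ => rfl, fun h' => absurd h' h⟩
  have hcont : ContinuousOn (fun y => (u y).re + ε * ‖y‖ ^ 2) (closedBall 0 R) :=
    (Complex.continuous_re.comp_continuousOn (hu.contDiffOn.continuousOn.mono hsub)).add
      (by fun_prop)
  obtain ⟨x, hx, hxmax⟩ := (isCompact_closedBall (0 : ℂ) R).exists_isMaxOn
    ⟨z, by simpa using hRz.le⟩ hcont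
  have hxz : (u z).re + ε * ‖z‖ ^ 2 ≤ (u x).re + ε * ‖x‖ ^ 2 :=
    hxmax (by simpa using hRz.le : z ∈ closedBall (0 : ℂ) R)
  have hx1 : ‖x‖ < 1 := by simpa using hsub hx
  have hxe : ε * ‖x‖ ^ 2 ≤ ε := by
    have : ‖x‖ ^ 2 ≤ 1 := pow_le_one₀ (norm_nonneg x) hx1.le
    nlinarith
  have hze : 0 ≤ ε * ‖z‖ ^ 2 := by positivity
  have hxpos : δ < (u x).re := by linarith
  have hxR : ‖x‖ < R := by
    by_contra! h
    linarith [hbd x (hRR.le.trans h) hx1]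
  have hloc : IsLocalMax (fun y => (u y).re + ε * ‖y‖ ^ 2) x := by
    have : closedBall (0 : ℂ) R ∈ 𝓝 x :=
      mem_of_superset (isOpen_ball.mem_nhds (by simpa using hxR)) ball_subset_closedBall
    exact hxmax.isLocalMax this
  have hnorm : ∀ y : ℂ, ‖y‖ ^ 2 = y.re ^ 2 + y.im ^ 2 := fun y => by
    rw [← Complex.normSq_eq_norm_sq, Complex.normSq_apply]; ring
  obtain ⟨a1, a2⟩ := re_derivs_of_isLocalMax (d := 1) (m := x.re) (hu.contDiffAt (hsub hx))
    (fun s => by rw [hnorm, hnorm]; simp; ring) hloc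
  obtain ⟨b1, b2⟩ := re_derivs_of_isLocalMax (d := Complex.I) (m := x.im)
    (hu.contDiffAt (hsub hx)) (fun s => by rw [hnorm, hnorm]; simp; ring) hloc
  have hL := (T_eq_zero_iff α u (hsub hx)).1 (hu.eq_zero x (hsub hx))
  rw [L, fderiv_apply_self] at hL
  have hre := congrArg Complex.re hL
  simp only [Complex.add_re, Complex.sub_re, Complex.re_ofReal_mul, Complex.real_smul,
    Complex.zero_re, a1, b1] at hre
  have hA := one_sub_norm_sq_pos (hsub hx)
  -- The real part of `L u = 0` at `x` is contradictory: the left side is at most `-4ε (1 - |x|²) <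
  -- 0` if `α = 0`, and at most `-α² Re u(x) < 0` otherwise.
  by_cases hα : α = 0
  · have := hε2 hα
    subst hα
    nlinarith
  · have h0 := hε1 hα
    have hα2 : 0 < α ^ 2 := by positivity
    rw [h0] at a2 b2 hre
    nlinarith [mul_pos hα2 (hδ0.trans hxpos)]

/-! ### The Poisson type integral as a solution, and distributional boundary values. -/

theorem isAlphaHarmonic_poisson (α : ℝ) (hf : Continuous f) :
    IsAlphaHarmonic α (poisson α f) := by
  have hg : Continuous fun t : ℝ => 1 / (2 * (Real.pi : ℂ)) * f (Circle.exp t) :=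
    continuous_const.mul (hf.comp Circle.exp.continuous)
  refine ((isAlphaHarmonic_kernel α).rotAverage hg).congr fun z _ => ?_
  rw [poisson, rotAverage, ← intervalIntegral.integral_const_mul]
  congr 1
  ext t
  rw [rot_apply, smul_eq_mul]
  ring

theorem continuous_comp_circle (hw : ContinuousOn w (ball 0 1)) {r : ℝ} (hr0 : 0 ≤ r)
    (hr1 : r < 1) : Continuous fun t : ℝ => w (r * (Circle.exp t : ℂ)) := by
  refine hw.comp_continuous ?_ fun t => ?_
  · exact continuous_const.mul (continuous_subtype_val.comp Circle.exp.continuous)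
  · simpa [abs_of_nonneg hr0] using hr1

/-- Boundedness on the compact disk and dominated convergence. Used for existence and for reducing
pointwise boundary values to distributional ones. -/
theorem hasDistributionalBoundaryValue_of_continuousOn (hv : ContinuousOn v (closedBall 0 1))
    (hvf : ∀ ζ : Circle, v ζ = f ζ) : HasDistributionalBoundaryValue v f := by
  intro φ hφ _
  obtain ⟨M, hM⟩ := (isCompact_closedBall (0 : ℂ) 1).exists_bound_of_continuousOn hv
  have hr : ∀ᶠ r : ℝ in 𝓝[<] 1, 0 < r ∧ r < 1 :=
    (eventually_nhdsWithin_of_eventually_nhds (lt_mem_nhds one_pos)).and self_mem_nhdsWithin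
  have hmem : ∀ r : ℝ, 0 < r ∧ r < 1 → ∀ t : ℝ,
      (r : ℂ) * (Circle.exp t : ℂ) ∈ closedBall (0 : ℂ) 1 := by
    intro r hr t
    simpa [abs_of_pos hr.1] using hr.2.le
  refine intervalIntegral.tendsto_integral_filter_of_dominated_convergence
    (fun t => M * ‖φ t‖) ?_ ?_ ?_ ?_
  · filter_upwards [hr] with r hr
    exact ((continuous_comp_circle (hv.mono ball_subset_closedBall) hr.1.le hr.2).mul
      hφ.continuous).aestronglyMeasurable
  · filter_upwards [hr] with r hr
    refine .of_forall fun t _ => ?_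
    rw [norm_mul]
    exact mul_le_mul_of_nonneg_right (hM _ (hmem r hr t)) (norm_nonneg _)
  · exact (continuous_const.mul hφ.continuous.norm).intervalIntegrable _ _
  · refine .of_forall fun t _ => Tendsto.mul_const _ ?_
    rw [← hvf]
    have h1 : (Circle.exp t : ℂ) ∈ closedBall (0 : ℂ) 1 := by
      rw [mem_closedBall_zero_iff, Circle.norm_coe]
    refine (hv _ h1).tendsto.comp (tendsto_nhdsWithin_iff.2 ⟨?_, ?_⟩)
    · have : Continuous fun r : ℝ => (r : ℂ) * (Circle.exp t : ℂ) := by fun_prop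
      simpa using (this.tendsto 1).mono_left nhdsWithin_le_nhds
    · filter_upwards [hr] with r hr using hmem r hr t

theorem HasDistributionalBoundaryValue.sub_of_eq_boundary (hu : HasDistributionalBoundaryValue u f)
    (hv : HasDistributionalBoundaryValue v f) (hcu : ContinuousOn u (ball 0 1))
    (hcv : ContinuousOn v (ball 0 1)) :
    HasDistributionalBoundaryValue (fun z => u z - v z) 0 := by
  intro φ hφ hper
  have h := (hu φ hφ hper).sub (hv φ hφ hper)
  simp only [sub_self, Pi.zero_apply, zero_mul, intervalIntegral.integral_zero] at h ⊢
  refine h.congr' ?_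
  have hr : ∀ᶠ r : ℝ in 𝓝[<] 1, 0 < r ∧ r < 1 :=
    (eventually_nhdsWithin_of_eventually_nhds (lt_mem_nhds one_pos)).and self_mem_nhdsWithin
  filter_upwards [hr] with r hr
  have hi : ∀ {g : ℂ → ℂ}, ContinuousOn g (ball 0 1) → IntervalIntegrable
      (fun t => g (r * (Circle.exp t : ℂ)) * φ t) volume 0 (2 * Real.pi) := fun hg =>
    ((continuous_comp_circle hg hr.1.le hr.2).mul hφ.continuous).intervalIntegrable _ _
  rw [← intervalIntegral.integral_sub (hi hcu) (hi hcv)]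
  simp only [sub_mul]

/-! ### Fourier modes and uniqueness. -/

/-- The character `t ↦ e^{-int}` of the circle. -/
noncomputable def character (n : ℤ) (t : ℝ) : ℂ := ((Circle.exp t ^ (-n) : Circle) : ℂ)

theorem character_eq_exp (n : ℤ) (t : ℝ) :
    character n t = Complex.exp (-(n : ℂ) * t * Complex.I) := by
  rw [character, Circle.coe_zpow, Circle.coe_exp, ← Complex.exp_int_mul]
  push_cast
  ring_nf

theorem contDiff_character (n : ℤ) : ContDiff ℝ ∞ (character n) := by
  simp only [funext (character_eq_exp n)]
  exact ((contDiff_const.mul Complex.ofRealCLM.contDiff).mul contDiff_const).cexp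

theorem periodic_character (n : ℤ) : Function.Periodic (character n) (2 * Real.pi) := by
  intro t
  simp only [character, Circle.periodic_exp t]

/-- The `n`-th Fourier coefficient, up to `2π`, of `w` on the circle of radius `r`. -/
noncomputable def circleCoeff (w : ℂ → ℂ) (n : ℤ) (r : ℝ) : ℂ :=
  ∫ t in (0 : ℝ)..(2 * Real.pi), w (r * (Circle.exp t : ℂ)) * character n t

/-- Convolution with a character projects onto its mode. As `character n` is `e^{-int}`, the mode
`e^{inθ}` is `character (-n)`. -/
theorem rotAverage_character (w : ℂ → ℂ) (n : ℤ) (c : ℂ) (r θ : ℝ) :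
    rotAverage w (fun t => c * character (-n) t) (r * (Circle.exp θ : ℂ))
      = c * character (-n) θ * circleCoeff w n r := by
  set H : ℝ → ℂ := fun t => w (r * (Circle.exp t : ℂ)) * character n t with hH
  have hper : Function.Periodic H (2 * Real.pi) := by
    intro t
    simp only [hH, periodic_character n t, Circle.periodic_exp t]
  have e1 := intervalIntegral.integral_comp_sub_left (a := 0) (b := 2 * Real.pi) H θ
  have e2 := hper.intervalIntegral_add_eq (θ - 2 * Real.pi) 0
  rw [sub_add_cancel, zero_add] at e2
  rw [sub_zero, e2] at e1
  rw [circleCoeff, ← e1, rotAverage, ← intervalIntegral.integral_const_mul]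
  congr 1
  ext t
  have h1 : rot t (r * (Circle.exp θ : ℂ)) = r * (Circle.exp (θ - t) : ℂ) := by
    rw [rot_apply, mul_assoc, ← Circle.coe_mul, ← Circle.exp_add, sub_eq_add_neg]
  have h2 : character (-n) t = character (-n) θ * character n (θ - t) := by
    simp only [character_eq_exp, ← Complex.exp_add]
    push_cast
    ring_nf
  simp only [hH, h1, smul_eq_mul]
  rw [h2]
  ring

/-- The projected mode has modulus `|c| |circleCoeff w n |z||`, which tends to 0 at the circle, so
the maximum principle applies for every multiplier `c`. -/
theorem circleCoeff_eq_zero (hw : IsAlphaHarmonic α w) (hb : HasDistributionalBoundaryValue w 0)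
    (n : ℤ) {r : ℝ} (hr0 : 0 ≤ r) (hr1 : r < 1) : circleCoeff w n r = 0 := by
  have hlim := hb (character n) (contDiff_character n) (periodic_character n)
  simp only [Pi.zero_apply, zero_mul, intervalIntegral.integral_zero] at hlim
  have hnorm : ∀ t, ‖character (-n) t‖ = 1 := fun t => Circle.norm_coe _
  have key : ∀ c : ℂ, (c * circleCoeff w n r).re ≤ 0 := by
    intro c
    have hW := hw.rotAverage (g := fun t => c * character (-n) t)
      (continuous_const.mul (contDiff_character _).continuous)
    have hle := hW.re_nonpos (fun ε hε => ?_) (z := r * (Circle.exp 0 : ℂ))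
      (by simpa [abs_of_nonneg hr0] using hr1)
    · rw [rotAverage_character] at hle
      simpa [character] using hle
    · have h1 : Tendsto (fun s => ‖c‖ * ‖circleCoeff w n s‖) (𝓝[<] 1) (𝓝 0) := by
        have := hlim.norm.const_mul ‖c‖
        rwa [norm_zero, mul_zero] at this
      obtain ⟨R, hR, hsub⟩ := (mem_nhdsLT_iff_exists_Ioo_subset' (zero_lt_one' ℝ)).1
        (h1.eventually_le_const hε)
      -- The interval obtained is open at `R`; the midpoint lies strictly inside it.
      refine ⟨(R + 1) / 2, by linarith [mem_Iio.1 hR], fun z hz hz1 => ?_⟩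
      have hz' : z = (‖z‖ : ℝ) * (Circle.exp z.arg : ℂ) := by
        rw [Circle.coe_exp, Complex.norm_mul_exp_arg_mul_I]
      have h2 : ‖c‖ * ‖circleCoeff w n ‖z‖‖ ≤ ε :=
        hsub ⟨by linarith [mem_Iio.1 hR], hz1⟩
      refine (Complex.re_le_norm _).trans ?_
      rw [hz', rotAverage_character, norm_mul, norm_mul, hnorm, mul_one]
      exact h2
  -- With `c` the conjugate of the coefficient, the inequality reads `|circleCoeff w n r|² ≤ 0`.
  have h := key ((starRingEnd ℂ) (circleCoeff w n r))
  rw [mul_comm, Complex.mul_conj, Complex.ofReal_re] at h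
  exact Complex.normSq_eq_zero.1 (le_antisymm h (Complex.normSq_nonneg _))

/-- On the circle through `z` the Fourier coefficients of `w` vanish, hence are summable, so the
Fourier series converges pointwise to `w` and its sum is 0. -/
theorem eq_zero_of_hasDistributionalBoundaryValue_zero (hw : IsAlphaHarmonic α w)
    (hb : HasDistributionalBoundaryValue w 0) {z : ℂ} (hz : z ∈ ball (0 : ℂ) 1) : w z = 0 := by
  have hz1 : ‖z‖ < 1 := by simpa using hz
  have : Fact (0 < 2 * Real.pi) := ⟨Real.two_pi_pos⟩
  let F : C(AddCircle (2 * Real.pi), ℂ) := ⟨fun x => w (‖z‖ * (x.toCircle : ℂ)), by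
    refine hw.contDiffOn.continuousOn.comp_continuous ?_ fun x => ?_
    · exact continuous_const.mul (continuous_subtype_val.comp AddCircle.continuous_toCircle)
    · simpa [Circle.norm_coe] using hz1⟩
  have hF : ∀ t : ℝ, F (t : AddCircle (2 * Real.pi)) = w (‖z‖ * (Circle.exp t : ℂ)) := by
    intro t
    have h : 2 * Real.pi / (2 * Real.pi) * t = t := by
      rw [div_self Real.two_pi_pos.ne', one_mul]
    simp only [F, ContinuousMap.coe_mk, AddCircle.toCircle_apply_mk, h]
  have hcoeff : fourierCoeff F = 0 := by
    ext n
    rw [fourierCoeff_eq_intervalIntegral F n 0, zero_add, Pi.zero_apply]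
    have : ∫ x in (0 : ℝ)..(2 * Real.pi), (fourier (-n)) (x : AddCircle (2 * Real.pi)) • F x
        = circleCoeff w n ‖z‖ := by
      rw [circleCoeff]
      congr 1
      ext t
      rw [hF, fourier_coe_apply, character_eq_exp, smul_eq_mul, mul_comm]
      congr 2
      have hpi : (Real.pi : ℂ) ≠ 0 := by exact_mod_cast Real.pi_ne_zero
      push_cast
      field_simp
    rw [this, circleCoeff_eq_zero hw hb n (norm_nonneg z) hz1, smul_zero]
  have hsum := has_pointwise_sum_fourier_series_of_summable (f := F)
    (by rw [hcoeff]; exact summable_zero) (z.arg : AddCircle (2 * Real.pi))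
  rw [hcoeff] at hsum
  simp only [Pi.zero_apply, zero_smul] at hsum
  have h0 := hsum.unique hasSum_zero
  rwa [hF, Circle.coe_exp, Complex.norm_mul_exp_arg_mul_I] at h0

theorem IsDirichletSolution.eqOn (hu : IsDirichletSolution α f u)
    (hv : IsDirichletSolution α f v) : EqOn u v (ball 0 1) := fun _ hz =>
  sub_eq_zero.1 (eq_zero_of_hasDistributionalBoundaryValue_zero
    (hu.isAlphaHarmonic.sub hv.isAlphaHarmonic)
    (hu.boundary.sub_of_eq_boundary hv.boundary hu.isAlphaHarmonic.contDiffOn.continuousOn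
      hv.isAlphaHarmonic.contDiffOn.continuousOn) hz)

/-! ### The continuous extension to the closed disk. -/

/-- The function equal to `P_α[f]` in the open disk and to `f (z / |z|)` outside. -/
noncomputable def poissonExtension (α : ℝ) (f : Circle → ℂ) (z : ℂ) : ℂ :=
  open Classical in if z ∈ ball (0 : ℂ) 1 then poisson α f z else f (Circle.exp z.arg)

theorem poissonExtension_of_mem {z : ℂ} (hz : z ∈ ball (0 : ℂ) 1) :
    poissonExtension α f z = poisson α f z := if_pos hz

theorem poissonExtension_of_notMem {z : ℂ} (hz : z ∉ ball (0 : ℂ) 1) :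
    poissonExtension α f z = f (Circle.exp z.arg) := if_neg hz

theorem poissonExtension_circle (α : ℝ) (f : Circle → ℂ) (ζ : Circle) :
    poissonExtension α f ζ = f ζ := by
  rw [poissonExtension_of_notMem (by simp [Circle.norm_coe]), Circle.exp_arg]

/-- `arg` jumps across the negative axis, but `e^{i arg z} = z/|z|` is continuous away from 0. -/
theorem tendsto_exp_arg (ζ : Circle) :
    Tendsto (fun z : ℂ => Circle.exp z.arg) (𝓝 (ζ : ℂ)) (𝓝 ζ) := by
  refine (IsInducing.mk rfl : IsInducing ((↑) : Circle → ℂ)).tendsto_nhds_iff.2 ?_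
  have h : Tendsto (fun z : ℂ => z / (‖z‖ : ℂ)) (𝓝 (ζ : ℂ)) (𝓝 (ζ : ℂ)) := by
    have hc : ContinuousAt (fun z : ℂ => z / (‖z‖ : ℂ)) (ζ : ℂ) :=
      continuousAt_id.div (Complex.continuous_ofReal.comp continuous_norm).continuousAt (by simp)
    simpa [ContinuousAt, Circle.norm_coe] using hc
  refine h.congr' ?_
  filter_upwards [isOpen_ne.mem_nhds (Circle.coe_ne_zero ζ)] with z hz
  have hn : (‖z‖ : ℂ) ≠ 0 := by simpa using hz
  rw [div_eq_iff hn, mul_comm]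
  exact (Complex.norm_mul_exp_arg_mul_I z).symm

theorem continuousOn_poissonExtension (hα : -1 < α) (hf : Continuous f) :
    ContinuousOn (poissonExtension α f) (closedBall 0 1) := by
  intro z hz
  by_cases hz1 : z ∈ ball (0 : ℂ) 1
  · have hc : ContinuousAt (poisson α f) z :=
      ((isAlphaHarmonic_poisson α hf).contDiffAt hz1).continuousAt
    refine (hc.congr ?_).continuousWithinAt
    filter_upwards [isOpen_ball.mem_nhds hz1] with y hy using (poissonExtension_of_mem hy).symm
  · have hnz : ‖z‖ = 1 := le_antisymm (by simpa using hz) (by simpa using hz1)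
    obtain ⟨ζ, rfl⟩ : ∃ ζ : Circle, (ζ : ℂ) = z :=
      ⟨⟨z, mem_sphere_zero_iff_norm.2 hnz⟩, rfl⟩
    have hexp := tendsto_exp_arg ζ
    have h1 : Tendsto (poissonExtension α f) (𝓝[ball 0 1] (ζ : ℂ)) (𝓝 (f ζ)) := by
      have hp : Tendsto (fun z : ℂ => (‖z‖, Circle.exp z.arg)) (𝓝[ball 0 1] (ζ : ℂ))
          (𝓝[<] 1 ×ˢ 𝓝 ζ) := by
        refine Tendsto.prodMk (tendsto_nhdsWithin_iff.2 ⟨?_, ?_⟩)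
          (hexp.mono_left nhdsWithin_le_nhds)
        · rw [← hnz]
          exact continuous_norm.continuousWithinAt
        · filter_upwards [self_mem_nhdsWithin] with y hy
          simpa using hy
      refine ((tendsto_poisson_polar hα hf ζ).comp hp).congr' ?_
      filter_upwards [self_mem_nhdsWithin] with y hy
      rw [poissonExtension_of_mem hy]
      simp only [Function.comp_apply, Circle.coe_exp, Complex.norm_mul_exp_arg_mul_I]
    have h2 : Tendsto (poissonExtension α f) (𝓝[(ball 0 1)ᶜ] (ζ : ℂ)) (𝓝 (f ζ)) := by
      refine ((hf.tendsto ζ).comp (hexp.mono_left nhdsWithin_le_nhds)).congr' ?_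
      filter_upwards [self_mem_nhdsWithin] with y hy using (poissonExtension_of_notMem hy).symm
    have h3 := h1.sup h2
    -- The disk and its complement cover the plane, so the two one-sided limits give a full limit at
    -- `ζ`.
    rw [← nhdsWithin_union, union_compl_self, nhdsWithin_univ] at h3
    rw [← poissonExtension_circle α f ζ] at h3
    exact h3.mono_left nhdsWithin_le_nhds

theorem isDirichletSolution_poissonExtension (hα : -1 < α) (hf : Continuous f) :
    IsDirichletSolution α f (poissonExtension α f) :=
  ⟨(isAlphaHarmonic_poisson α hf).congr fun _ hz => poissonExtension_of_mem hz,
    hasDistributionalBoundaryValue_of_continuousOn (continuousOn_poissonExtension hα hf)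
      (poissonExtension_circle α f)⟩

end AlphaHarmonic

theorem theorem1p2 (α : ℝ) (hα : -1 < α) (f : Circle → ℂ) (hf : Continuous f) :
    ∃ u : ℂ → ℂ,
      -- `u` is `P_α[f]` in the open disk and `f` on the circle
      (∀ z ∈ Metric.ball (0 : ℂ) 1, u z = AlphaHarmonic.poisson α f z) ∧
      (∀ ζ : Circle, u ζ = f ζ) ∧
      -- it solves the Dirichlet problem and is continuous on the closed disk
      AlphaHarmonic.IsDirichletSolution α f u ∧
      ContinuousOn u (Metric.closedBall 0 1) ∧
      -- uniqueness among the solutions that are continuous on the closed disk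
      (∀ v : ℂ → ℂ, AlphaHarmonic.IsDirichletSolution α f v →
        ContinuousOn v (Metric.closedBall 0 1) → Set.EqOn v u (Metric.closedBall 0 1)) ∧
      -- the same, with the boundary values taken pointwise
      (∀ v : ℂ → ℂ, AlphaHarmonic.IsAlphaHarmonic α v → (∀ ζ : Circle, v ζ = f ζ) →
        ContinuousOn v (Metric.closedBall 0 1) → Set.EqOn v u (Metric.closedBall 0 1)) ∧
      -- uniqueness in the open disk among all solutions
      (∀ v : ℂ → ℂ, AlphaHarmonic.IsDirichletSolution α f v →
        Set.EqOn v u (Metric.ball 0 1)) := by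
  have hsol := AlphaHarmonic.isDirichletSolution_poissonExtension hα hf
  have hcont := AlphaHarmonic.continuousOn_poissonExtension hα hf
  have huniq : ∀ v : ℂ → ℂ, AlphaHarmonic.IsDirichletSolution α f v →
      ContinuousOn v (Metric.closedBall 0 1) →
      Set.EqOn v (AlphaHarmonic.poissonExtension α f) (Metric.closedBall 0 1) := by
    intro v hv hvc
    -- Equality in the open disk extends to its closure by continuity.
    refine (hv.eqOn hsol).of_subset_closure hvc hcont Metric.ball_subset_closedBall ?_
    rw [closure_ball _ one_ne_zero]
  exact ⟨AlphaHarmonic.poissonExtension α f,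
    fun z hz => AlphaHarmonic.poissonExtension_of_mem hz,
    AlphaHarmonic.poissonExtension_circle α f, hsol, hcont, huniq,
    fun v hv hvf hvc => huniq v
      ⟨hv, AlphaHarmonic.hasDistributionalBoundaryValue_of_continuousOn hvc hvf⟩ hvc,
    fun v hv => hv.eqOn hsol⟩
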